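/- All graphs are finite and simple. Let $T$ be a tree. - A subtree of $T$ is a connected induced subgraph with at least one edge, and $S_T(q,r)=\sum_{S} q^{|E(S)|}r^{|L(S)|}$ is the bivariate subtree polynomial, where $S$ ranges over the subtrees of $T$ and $L(S)$ is the set of leaves (vertices of degree $1$) of $S$. - $X_T(x_1,x_2,\dots)=\sum_{\kappa}\prod_{v\in V(T)}x_{\kappa(v)}$ is the chromatic symmetric function, where $\kappa$ ranges over the proper colorings $V(T)\to\mathbb{Z}^+$. - The trunk $T^{\circ}$ is the smallest connected induced subgraph of $T$ containing all vertices of degree at least $3$ (the empty graph if $T$ has no such vertex), and its size $|T^\circ|$ is its number of vertices. - A twig of $T$ is a path in $T$, with at least one edge, which for some leaf $l$ of $T$ is a longest path among those that contain $l$ and whose interior vertices all have degree $2$ in $T$. A path and its reverse are the same twig, and the length of a twig is its number of edges. - A spider is a tree with at most one vertex of degree at least $3$. **Theorem.** Let $T$ and $T'$ be trees. 1. If $S_T=S_{T'}$, then $|T^{\circ}|=|T'^{\circ}|$, and the multisets of the lengths of the twigs of $T$ and of $T'$ are equal. 2. If $X_T=X_{T'}$, then likewise $|T^{\circ}|=|T'^{\circ}|$,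 and the multisets of the lengths of the twigs of $T$ and of $T'$ are equal. 3. If $T$ is a spider and $X_T=X_{T'}$, then $T$ and $T'$ are isomorphic. -/

import Mathlib

namespace SimpleGraph

section Definitions

variable {V : Type*} [Fintype V]

/-- The chromatic symmetric function
`X_G(x₁, x₂, …) = ∑_{κ proper} ∏_{v ∈ V(G)} x_{κ(v)}`, where `κ` ranges over the proper colorings
of `G` by positive integers, as a formal power series in variables indexed by the positive integers.
The coefficient of the monomial `x ^ m` is the number of proper colorings `κ` with
`∏_v x_{κ(v)} = x ^ m`; see `hasSum_chromaticSymmetricFunction` below for the formal sum. -/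
noncomputable def chromaticSymmetricFunction (G : SimpleGraph V) : MvPowerSeries ℕ+ ℤ :=
  fun m : ℕ+ →₀ ℕ =>
    (({κ : G.Coloring ℕ+ | ∑ v, Finsupp.single (κ v) 1 = m}.ncard : ℕ) : ℤ)

/-- The set counted by a coefficient of `X_G` is finite, so that its cardinality is meaningful. -/
theorem finite_setOf_coloring_monomial (G : SimpleGraph V) (m : ℕ+ →₀ ℕ) :
    {κ : G.Coloring ℕ+ | ∑ v, Finsupp.single (κ v) 1 = m}.Finite := by
  classical
  have hfin : {f : V → ℕ+ | ∀ v, f v ∈ (m.support : Set ℕ+)}.Finite := by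
    have h := Set.Finite.pi' (fun _ : V => m.support.finite_toSet)
    simpa using h
  refine (hfin.preimage (f := fun κ : G.Coloring ℕ+ => (κ : V → ℕ+))
    DFunLike.coe_injective.injOn).subset ?_
  intro κ hκ v
  have hκ' : ∑ v, Finsupp.single (κ v) 1 = m := hκ
  simp only [Finset.mem_coe, Finsupp.mem_support_iff]
  rw [← hκ', Finsupp.finsetSum_apply]
  intro h0
  have := (Finset.sum_eq_zero_iff.mp h0) v (Finset.mem_univ v)
  simp at this

open scoped MvPowerSeries.WithPiTopology in
/-- `X_G` is the sum, in the ring of formal power series, of the monomials `∏_v x_{κ(v)}` over all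
proper colorings `κ` of `G`. -/
theorem hasSum_chromaticSymmetricFunction (G : SimpleGraph V) :
    HasSum (fun κ : G.Coloring ℕ+ => ∏ v, (MvPowerSeries.X (κ v) : MvPowerSeries ℕ+ ℤ))
      G.chromaticSymmetricFunction := by
  classical
  rw [MvPowerSeries.WithPiTopology.hasSum_iff_hasSum_coeff]
  intro m
  have hprod : ∀ κ : G.Coloring ℕ+, ∏ v, (MvPowerSeries.X (κ v) : MvPowerSeries ℕ+ ℤ) =
      MvPowerSeries.monomial (∑ v, Finsupp.single (κ v) 1) 1 := by
    intro κ
    simp only [MvPowerSeries.X]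
    induction (Finset.univ : Finset V) using Finset.induction_on with
    | empty => simp
    | insert a s ha ih =>
      rw [Finset.prod_insert ha, Finset.sum_insert ha, ih, MvPowerSeries.monomial_mul_monomial,
        one_mul]
  have hfin := finite_setOf_coloring_monomial G m
  have hval : MvPowerSeries.coeff m G.chromaticSymmetricFunction =
      ∑ κ ∈ hfin.toFinset,
        MvPowerSeries.coeff m (∏ v, (MvPowerSeries.X (κ v) : MvPowerSeries ℕ+ ℤ)) := by
    rw [Finset.sum_congr rfl (g := fun _ => (1 : ℤ))]
    · rw [Finset.sum_const, nsmul_eq_mul, mul_one, ← Set.ncard_eq_toFinset_card _ hfin]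
      rfl
    · intro κ hκ
      have hκ' : ∑ v, Finsupp.single (κ v) 1 = m := hfin.mem_toFinset.mp hκ
      rw [hprod, hκ', MvPowerSeries.coeff_monomial_same]
  rw [hval]
  refine hasSum_sum_of_ne_finset_zero ?_
  intro κ hκ
  rw [hprod, MvPowerSeries.coeff_monomial, if_neg]
  intro h
  exact hκ (hfin.mem_toFinset.mpr h.symm)

/-- The set `s` of vertices induces a subtree of the tree `T`: a connected induced subgraph with at
least one edge. -/
def IsSubtree (T : SimpleGraph V) (s : Finset V) : Prop :=
  (T.induce (s : Set V)).Connected ∧ (T.induce (s : Set V)).edgeSet.Nonempty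

open Classical in
/-- The bivariate subtree polynomial `S_T(q, r) = ∑_S q ^ |E(S)| r ^ |L(S)|`, where `S` ranges over
the subtrees of `T` and `L(S)` is the set of leaves of `S`. The variables are `q = X 0` and
`r = X 1`. -/
noncomputable def subtreePolynomial (T : SimpleGraph V) : MvPolynomial (Fin 2) ℤ :=
  ∑ s : Finset V with T.IsSubtree s,
    MvPolynomial.X 0 ^ (T.induce (s : Set V)).edgeFinset.card *
      MvPolynomial.X 1 ^
        (Finset.univ.filter fun x => (T.induce (s : Set V)).degree x = 1).card

open Classical in
/-- The vertex set of the trunk of `T`, the smallest connected induced subgraph containing all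
vertices of degree at least `3`: the intersection of all connected vertex sets that contain these
vertices. The empty vertex set counts as connected, so the trunk is empty if there is no vertex of
degree at least `3`. For a tree this intersection is indeed the least such set, see
`isLeast_trunk`. -/
def trunk (T : SimpleGraph V) : Set V :=
  ⋂₀ {s : Set V | (T.induce s).Preconnected ∧ ∀ v, 3 ≤ T.degree v → v ∈ s}

open Classical in
/-- For a tree, the trunk is the least connected set of vertices that contains all vertices of
degree at least `3`. -/
theorem isLeast_trunk (T : SimpleGraph V) (hT : T.IsTree) :
    IsLeast {s : Set V | (T.induce s).Preconnected ∧ ∀ v, 3 ≤ T.degree v → v ∈ s} T.trunk := by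
  refine ⟨⟨?_, fun v hv s hs => hs.2 v hv⟩, fun s hs => Set.sInter_subset_of_mem hs⟩
  rintro ⟨x, hx⟩ ⟨y, hy⟩
  obtain ⟨p, hp, huniq⟩ := hT.existsUnique_path x y
  have hsub : ∀ z ∈ p.support, z ∈ T.trunk := by
    intro z hz s hs
    have hxs : x ∈ s := hx s hs
    have hys : y ∈ s := hy s hs
    obtain ⟨q, hq⟩ := (hs.1 ⟨x, hxs⟩ ⟨y, hys⟩).exists_isPath
    have hq' := huniq _ (hq.map (f := (Embedding.induce s).toHom) Subtype.val_injective)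
    have hmem : z ∈ q.support.map (Embedding.induce (G := T) s).toHom := by
      rw [← Walk.support_map]
      rw [← hq'] at hz
      exact hz
    obtain ⟨w, -, rfl⟩ := List.mem_map.mp hmem
    exact w.2
  exact ⟨p.induce T.trunk hsub⟩

open Classical in
/-- A path of `T` (with at least one edge) all of whose interior vertices have degree `2` in `T`. -/
def IsBarePath (T : SimpleGraph V) {u v : V} (p : T.Walk u v) : Prop :=
  p.IsPath ∧ 1 ≤ p.length ∧ ∀ w ∈ p.support, w ≠ u → w ≠ v → T.degree w = 2

/-- `p` is a twig of `l`: a longest path containing `l` all of whose interior vertices have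
degree `2` in `T`. -/
def IsTwigOf (T : SimpleGraph V) (l : V) {u v : V} (p : T.Walk u v) : Prop :=
  T.IsBarePath p ∧ l ∈ p.support ∧
    ∀ (u' v' : V) (q : T.Walk u' v'), T.IsBarePath q → l ∈ q.support → q.length ≤ p.length

open Classical in
/-- The twigs of `T`: the paths that are a twig of some leaf of `T`. A path is recorded by its set
of edges, so that a path and its reverse are the same twig. -/
noncomputable def twigs (T : SimpleGraph V) : Finset (Finset (Sym2 V)) :=
  Finset.univ.filter fun E => ∃ (l u v : V) (p : T.Walk u v),
    T.degree l = 1 ∧ T.IsTwigOf l p ∧ p.edges.toFinset = E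

/-- The multiset of the lengths (numbers of edges) of the twigs of `T`. -/
noncomputable def twigLengths (T : SimpleGraph V) : Multiset ℕ :=
  T.twigs.val.map Finset.card

open Classical in
/-- A spider: a tree with at most one vertex of degree at least `3`. -/
def IsSpider (T : SimpleGraph V) : Prop :=
  T.IsTree ∧ {v | 3 ≤ T.degree v}.Subsingleton

end Definitions

end SimpleGraph

/-! Suppose `T` has a vertex `c` of degree at least `3`, and root `T` there. From each leaf `l` a
leg climbs to the first vertex whose degree is not `2`; let `a l` be its length. Legs are exactly
the twigs. They are disjoint apart from their upper ends, and deleting them (upper ends excepted)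
leaves the trunk, so `|T°| + ∑ a l = n`. More generally, the connected vertex sets containing the
trunk arise by deleting the first `k l ≤ a l` vertices of each leg, the numbers `k l` being
independent. Hence a family of such sets defined leg by leg has a product as its generating function
for the number of deleted vertices.

Both invariants yield the product `P = ∏ (1 + X + ... + X ^ (a l - 1))`. It determines the multiset
of the `a l` once the number of legs is known, since that number fixes the power of `X - 1` by which
`P` becomes `∏ (X ^ a l - 1)`, and roots of unity recover the exponents. The number of legs is the
number of leaves, `2 + degreeExcess`.

For `S_T`: a subtree has the maximal number of leaves exactly when it contains all vertices of
degree at least `3` and their neighbours, that is, when `k l < a l` for all `l`. The complement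
sizes of these subtrees give `P`.

For `X_T`: split the colors into two parts of sizes `k + 1` and `l + 1`. The number of proper
colorings in which `s` is the set of vertices with a color of the first part depends only on `|s|`,
`e(s)` and `e(sᶜ)`, where `e` counts inside edges. Varying `k` and `l` shows that `X_T` determines
the multiset of these triples. If `e(s) + 1 = |s|`, a degree count bounds `e(sᶜ) + |s|` below by `n
- 2 - degreeExcess`, with equality exactly when `s` contains all vertices of degree at least `3` and
no leaf of `T`. This recovers `degreeExcess`, and the extremal sets are given by `1 ≤ k l ≤ a l`,
with generating function `X ^ (2 + degreeExcess) * P`.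

Trees without a vertex of degree at least `3` are paths and are treated separately. A spider is a
set of legs glued at one vertex, so part 3 follows from part 2. -/

namespace SimpleGraph

/-! ### Rooted trees and their parent maps -/

section RootedTrees

open scoped Classical

variable {V : Type*} {T : SimpleGraph V} {c : V} {p : V → V} {d : V → ℕ}

/-- `p` is the parent map, and `d` a depth function, of the tree `T` rooted at `c`. The root is its
own parent. -/
structure IsRootedBy (T : SimpleGraph V) (c : V) (p : V → V) (d : V → ℕ) : Prop where
  root : p c = c
  depth : ∀ v, v ≠ c → d v = d (p v) + 1
  adj_iff : ∀ u v, T.Adj u v ↔ u ≠ v ∧ (p u = v ∨ p v = u)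

/-- The parent of `v` is the second vertex on the path from `v` to `c`, and the depth is the length
of that path. -/
theorem IsTree.exists_isRootedBy (hT : T.IsTree) (c : V) : ∃ p d, T.IsRootedBy c p d := by
  choose P hP huniq using fun v => hT.existsUnique_path v c
  refine ⟨fun v => (P v).snd, fun v => (P v).length, ?_, ?_, ?_⟩
  · have : P c = Walk.nil := (huniq c _ Walk.IsPath.nil).symm
    simp [this]
  · intro v hv
    have hn : ¬ (P v).Nil := Walk.not_nil_of_ne hv
    have h := huniq _ _ (hP v).tail
    rw [← Walk.length_tail_add_one hn]
    rw [h]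
  · intro u v
    constructor
    · intro h
      refine ⟨h.ne, ?_⟩
      by_cases hv : v ∈ (P u).support
      · exact Or.inl (hT.isAcyclic.eq_snd_of_adj_start (hP u) h hv).symm
      · by_cases hu : u ∈ (P v).support
        · exact Or.inr (hT.isAcyclic.eq_snd_of_adj_start (hP v) h.symm hu).symm
        · have h1 := huniq v (Walk.cons h.symm (P u)) ((hP u).cons hv)
          right
          rw [← h1]
          simp
    · have key : ∀ u v, u ≠ v → (P u).snd = v → T.Adj u v := by
        intro u v huv h
        have hn : ¬ (P u).Nil := by
          intro hnil
          apply huv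
          rw [← h]
          rw [Walk.snd, Walk.getVert_of_length_le _ (by simp [Walk.length_eq_zero_iff.mpr hnil])]
          exact hnil.eq
        rw [← h]
        exact (P u).adj_snd hn
      rintro ⟨hne, h | h⟩
      · exact key u v hne h
      · exact (key v u hne.symm h).symm

namespace IsRootedBy

theorem parent_ne (h : T.IsRootedBy c p d) {v : V} (hv : v ≠ c) : p v ≠ v := by
  intro hp
  have := h.depth v hv
  rw [hp] at this
  omega

theorem adj_parent (h : T.IsRootedBy c p d) {v : V} (hv : v ≠ c) : T.Adj v (p v) :=
  (h.adj_iff _ _).mpr ⟨(h.parent_ne hv).symm, Or.inl rfl⟩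

theorem ne_root_of_parent_ne_root (h : T.IsRootedBy c p d) {v : V} (hv : p v ≠ c) : v ≠ c := by
  rintro rfl
  exact hv h.root

theorem iterate_root (h : T.IsRootedBy c p d) (i : ℕ) : p^[i] c = c :=
  Function.iterate_fixed h.root i

theorem exists_iterate_eq_root (h : T.IsRootedBy c p d) (v : V) : ∃ i, p^[i] v = c := by
  induction hn : d v generalizing v with
  | zero =>
    refine ⟨0, ?_⟩
    by_contra hv
    have := h.depth v hv
    omega
  | succ n ih =>
    by_cases hv : v = c
    · exact ⟨0, hv⟩
    · obtain ⟨i, hi⟩ := ih (p v) (by have := h.depth v hv; omega)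
      exact ⟨i + 1, by rwa [Function.iterate_succ_apply]⟩

theorem iterate_eq_root_of_le (h : T.IsRootedBy c p d) {v : V} {i j : ℕ} (hi : p^[i] v = c)
    (hij : i ≤ j) : p^[j] v = c := by
  obtain ⟨k, rfl⟩ := Nat.exists_eq_add_of_le' hij
  rw [Function.iterate_add_apply, hi, h.iterate_root]

/-- Turns connectedness into closure under one function, the form in which it can be checked leg by
leg. -/
theorem preconnected_induce_iff (h : T.IsRootedBy c p d) {s : Set V} (hc : c ∈ s) :
    (T.induce s).Preconnected ↔ ∀ v ∈ s, p v ∈ s := by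
  constructor
  · intro hs v hv
    by_contra hpv
    have hvc : v ≠ c := by
      rintro rfl
      exact hpv (h.root.symm ▸ hv)
    -- If `p v` is missing, a walk inside `s` cannot leave the descendants of `v`, because the only
    -- exit is the edge from `v` to `p v`.
    have key : ∀ x y : s, (T.induce s).Walk x y → (∃ i, p^[i] (x : V) = v) →
        ∃ i, p^[i] (y : V) = v := by
      intro x y w
      induction w with
      | nil => exact id
      | @cons x y z hxy w ih =>
        rintro ⟨i, hi⟩
        apply ih
        have hadj : T.Adj (x : V) y := hxy
        rcases ((h.adj_iff _ _).mp hadj).2 with h1 | h1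
        · cases i with
          | zero =>
            exfalso
            apply hpv
            rw [← show (x : V) = v from hi, h1]
            exact y.2
          | succ i => exact ⟨i, by rwa [Function.iterate_succ_apply, h1] at hi⟩
        · exact ⟨i + 1, by rwa [Function.iterate_succ_apply, h1]⟩
    obtain ⟨w⟩ := hs ⟨v, hv⟩ ⟨c, hc⟩
    obtain ⟨i, hi⟩ := key _ _ w ⟨0, rfl⟩
    exact hvc (hi.symm.trans (h.iterate_root i))
  · intro hs
    have key : ∀ (i : ℕ) (v : V) (hv : v ∈ s), p^[i] v = c →
        (T.induce s).Reachable ⟨v, hv⟩ ⟨c, hc⟩ := by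
      intro i
      induction i with
      | zero =>
        intro v hv hi
        have : v = c := hi
        subst this
        rfl
      | succ i ih =>
        intro v hv hi
        by_cases hvc : v = c
        · subst hvc
          rfl
        · refine Reachable.trans (Adj.reachable ?_) (ih (p v) (hs v hv) hi)
          exact h.adj_parent hvc
    rintro ⟨x, hx⟩ ⟨y, hy⟩
    obtain ⟨i, hi⟩ := h.exists_iterate_eq_root x
    obtain ⟨j, hj⟩ := h.exists_iterate_eq_root y
    exact (key i x hx hi).trans (key j y hy hj).symm

variable [Fintype V]

theorem degree_eq (h : T.IsRootedBy c p d) (v : V) :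
    T.degree v = (Finset.univ.filter fun u => u ≠ c ∧ p u = v).card + if v = c then 0 else 1 := by
  have hn : T.neighborFinset v =
      (Finset.univ.filter fun u => u ≠ c ∧ p u = v) ∪ (if v = c then ∅ else {p v}) := by
    ext u
    rw [mem_neighborFinset, h.adj_iff]
    split_ifs with hv
    · subst hv
      simp only [Finset.mem_union, Finset.mem_filter, Finset.mem_univ, true_and,
        Finset.notMem_empty, or_false, h.root]
      grind
    · simp only [Finset.mem_union, Finset.mem_filter, Finset.mem_univ, true_and,
        Finset.mem_singleton]
      have := h.parent_ne hv
      have h2 := fun hu => h.parent_ne (v := u) hu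
      have := h.root
      grind
  rw [← card_neighborFinset_eq_degree, hn, Finset.card_union_of_disjoint]
  · split_ifs <;> simp
  · split_ifs with hv
    · simp
    · rw [Finset.disjoint_singleton_right]
      simp only [Finset.mem_filter, Finset.mem_univ, true_and, not_and]
      intro hpv h2
      have h3 := h.depth v hv
      have h4 := h.depth _ hpv
      rw [h2] at h4
      omega

theorem parent_ne_of_degree_eq_one (h : T.IsRootedBy c p d) {v : V} (hv : v ≠ c)
    (hd : T.degree v = 1) {u : V} (hu : u ≠ c) : p u ≠ v := by
  intro hp
  rw [h.degree_eq, if_neg hv] at hd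
  have : (Finset.univ.filter fun u => u ≠ c ∧ p u = v) = ∅ :=
    Finset.card_eq_zero.mp (by omega)
  have h2 : u ∈ (Finset.univ.filter fun u => u ≠ c ∧ p u = v) := by simp [hu, hp]
  rw [this] at h2
  simp at h2

theorem eq_of_parent_eq (h : T.IsRootedBy c p d) {v : V} (hv : v ≠ c) (hd : T.degree v ≤ 2)
    {u w : V} (hu : u ≠ c) (hw : w ≠ c) (hpu : p u = v) (hpw : p w = v) : u = w := by
  rw [h.degree_eq, if_neg hv] at hd
  exact Finset.card_le_one.mp (show (Finset.univ.filter fun u => u ≠ c ∧ p u = v).card ≤ 1 by omega)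
    u (by simp [hu, hpu]) w (by simp [hw, hpw])

/-- A descendant of `v` of maximal depth has no children. -/
theorem exists_leaf (h : T.IsRootedBy c p d) {v : V} (hv : v ≠ c) :
    ∃ l i, l ≠ c ∧ T.degree l = 1 ∧ p^[i] l = v := by
  obtain ⟨l, hl, hmax⟩ := Finset.exists_max_image (Finset.univ.filter fun u => ∃ i, p^[i] u = v) d
    ⟨v, by simpa using ⟨0, rfl⟩⟩
  simp only [Finset.mem_filter, Finset.mem_univ, true_and] at hl hmax
  obtain ⟨i, hi⟩ := hl
  have hlc : l ≠ c := by
    rintro rfl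
    exact hv (hi.symm.trans (h.iterate_root i))
  refine ⟨l, i, hlc, ?_, hi⟩
  rw [h.degree_eq, if_neg hlc, Finset.card_eq_zero.mpr]
  rw [Finset.filter_eq_empty_iff]
  rintro u - ⟨hu, hpu⟩
  have h1 := hmax u ⟨i + 1, by rwa [Function.iterate_succ_apply, hpu]⟩
  have h2 := h.depth u hu
  rw [hpu] at h2
  omega

end IsRootedBy

/-- The number of steps from the leaf `l` towards the root until the first vertex whose degree is
not `2`. -/
noncomputable def legLength [Fintype V] (T : SimpleGraph V) (p : V → V) (l : V) : ℕ :=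
  sInf {i | 1 ≤ i ∧ T.degree (p^[i] l) ≠ 2}

namespace IsRootedBy

variable [Fintype V]

/-- The root has degree other than `2`, so the climb stops there at the latest and the infimum is
attained. -/
theorem legLength_spec (h : T.IsRootedBy c p d) (hc : T.degree c ≠ 2) {l : V} (hl : l ≠ c) :
    1 ≤ T.legLength p l ∧ T.degree (p^[T.legLength p l] l) ≠ 2 := by
  have : ({i | 1 ≤ i ∧ T.degree (p^[i] l) ≠ 2} : Set ℕ).Nonempty := by
    obtain ⟨i, hi⟩ := h.exists_iterate_eq_root l
    refine ⟨i, ?_, by rwa [hi]⟩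
    rcases Nat.eq_zero_or_pos i with rfl | h0
    · exact absurd hi hl
    · exact h0
  exact Nat.sInf_mem this

theorem degree_iterate_eq_two {l : V} {i : ℕ} (hi : 1 ≤ i)
    (hil : i < T.legLength p l) : T.degree (p^[i] l) = 2 := by
  by_contra hd
  exact absurd (Nat.sInf_le (s := {i | 1 ≤ i ∧ T.degree (p^[i] l) ≠ 2}) ⟨hi, hd⟩) (not_le.mpr hil)

theorem degree_iterate_le_two {l : V} (hd : T.degree l = 1) {i : ℕ}
    (hil : i < T.legLength p l) : T.degree (p^[i] l) ≤ 2 := by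
  rcases Nat.eq_zero_or_pos i with rfl | h0
  · exact hd.le.trans one_le_two
  · exact (degree_iterate_eq_two h0 hil).le

theorem iterate_ne_root (hc : T.degree c ≠ 2) {l : V} (hl : l ≠ c)
    {i : ℕ} (hil : i < T.legLength p l) : p^[i] l ≠ c := by
  rcases Nat.eq_zero_or_pos i with rfl | h0
  · exact hl
  · intro h1
    exact hc (h1 ▸ degree_iterate_eq_two h0 hil)

/-- A vertex on a leg lies on only one path from a leaf to the root. -/
theorem eq_of_iterate_eq (h : T.IsRootedBy c p d) (hc : T.degree c ≠ 2) {l m : V}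
    (hm : m ≠ c) (hdl : T.degree l = 1) (hdm : T.degree m = 1) {i j : ℕ}
    (hj : j < T.legLength p m) (hij : p^[i] l = p^[j] m) : l = m ∧ i = j := by
  induction j generalizing i with
  | zero =>
    cases i with
    | zero => exact ⟨hij, rfl⟩
    | succ i =>
      exfalso
      rw [Function.iterate_succ_apply'] at hij
      refine h.parent_ne_of_degree_eq_one hm hdm ?_ hij
      exact h.ne_root_of_parent_ne_root (hij ▸ hm)
  | succ j ih =>
    have hmc := iterate_ne_root hc hm hj
    have hmc' := iterate_ne_root hc hm (Nat.lt_of_succ_lt hj)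
    cases i with
    | zero =>
      exfalso
      have h2 := degree_iterate_eq_two (by omega) hj
      rw [← hij] at h2
      exact absurd (h2.symm.trans hdl) (by norm_num)
    | succ i =>
      -- A vertex of degree at most `2` other than the root has at most one child, so both climbs
      -- reached it from the same vertex.
      have hd := degree_iterate_le_two hdm hj
      have := ih (i := i) (Nat.lt_of_succ_lt hj) (by
        rw [Function.iterate_succ_apply', Function.iterate_succ_apply'] at hij
        rw [Function.iterate_succ_apply'] at hmc hd
        exact h.eq_of_parent_eq hmc hd (h.ne_root_of_parent_ne_root (hij ▸ hmc)) hmc' hij rfl)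
      exact ⟨this.1, by rw [this.2]⟩

end IsRootedBy

end RootedTrees

end SimpleGraph
namespace SimpleGraph

/-! ### Cutting off initial parts of the legs -/

section Legs

open scoped Classical

variable {V : Type*} [Fintype V] {T : SimpleGraph V} {c : V} {p : V → V} {d : V → ℕ}

/-- The leaves of `T` other than the root `c`. -/
abbrev Tip (T : SimpleGraph V) (c : V) : Type _ := {l : V // l ≠ c ∧ T.degree l = 1}

/-- The first `k l` vertices on the way from each leaf `l` to the root. -/
noncomputable def legCut (T : SimpleGraph V) (c : V) (p : V → V) (k : T.Tip c → ℕ) : Finset V :=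
  Finset.univ.filter fun v => ∃ l : T.Tip c, ∃ i < k l, p^[i] l = v

/-- The set `s` contains all vertices of degree at least `3`, and with each vertex its parent. -/
structure IsTrunkLike (T : SimpleGraph V) (p : V → V) (s : Finset V) : Prop where
  mem_of_degree : ∀ v, 3 ≤ T.degree v → v ∈ s
  parent_mem : ∀ v ∈ s, p v ∈ s

namespace IsTrunkLike

theorem iterate_mem {s : Finset V} (hs : T.IsTrunkLike p s) {v : V} (hv : v ∈ s) (i : ℕ) :
    p^[i] v ∈ s := by
  induction i with
  | zero => exact hv
  | succ i ih =>
    rw [Function.iterate_succ_apply']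
    exact hs.parent_mem _ ih

theorem iterate_mem_of_le {s : Finset V} (hs : T.IsTrunkLike p s) {v : V} {i j : ℕ} (hij : i ≤ j)
    (hv : p^[i] v ∈ s) : p^[j] v ∈ s := by
  obtain ⟨k, rfl⟩ := Nat.exists_eq_add_of_le' hij
  rw [Function.iterate_add_apply]
  exact hs.iterate_mem hv k

end IsTrunkLike

namespace IsRootedBy

theorem exists_tip_iterate_eq [Nontrivial V] (h : T.IsRootedBy c p d) (v : V) :
    ∃ (l : T.Tip c) (i : ℕ), p^[i] l = v := by
  by_cases hv : v = c
  · obtain ⟨u, hu⟩ := exists_ne c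
    obtain ⟨l, -, hl, hd, -⟩ := h.exists_leaf hu
    obtain ⟨i, hi⟩ := h.exists_iterate_eq_root l
    exact ⟨⟨l, hl, hd⟩, i, hi.trans hv.symm⟩
  · obtain ⟨l, i, hl, hd, hi⟩ := h.exists_leaf hv
    exact ⟨⟨l, hl, hd⟩, i, hi⟩

/-- An upper end other than the root has a child and a parent, so its degree, not being `2`, is at
least `3`. -/
theorem iterate_legLength (h : T.IsRootedBy c p d) (hc : T.degree c ≠ 2) {l : V} (hl : l ≠ c) :
    p^[T.legLength p l] l = c ∨ 3 ≤ T.degree (p^[T.legLength p l] l) := by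
  by_cases hr : p^[T.legLength p l] l = c
  · exact Or.inl hr
  · right
    obtain ⟨h1, h2⟩ := h.legLength_spec hc hl
    have h3 := h.degree_eq (p^[T.legLength p l] l)
    rw [if_neg hr] at h3
    have h4 : 0 < (Finset.univ.filter fun u => u ≠ c ∧ p u = p^[T.legLength p l] l).card := by
      refine Finset.card_pos.mpr ⟨p^[T.legLength p l - 1] l, ?_⟩
      simp only [Finset.mem_filter, Finset.mem_univ, true_and]
      refine ⟨iterate_ne_root hc hl (by omega), ?_⟩
      rw [← Function.iterate_succ_apply' p, Nat.succ_eq_add_one, Nat.sub_add_cancel h1]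
    omega

section Cuts

variable {k : T.Tip c → ℕ}

theorem iterate_mem_legCut (h : T.IsRootedBy c p d) (hc : T.degree c ≠ 2)
    (hk : ∀ l, k l ≤ T.legLength p l) (l : T.Tip c) (i : ℕ) :
    p^[i] l ∈ T.legCut c p k ↔ i < k l := by
  simp only [legCut, Finset.mem_filter, Finset.mem_univ, true_and]
  constructor
  · rintro ⟨m, j, hj, hjm⟩
    obtain ⟨h1, h2⟩ := h.eq_of_iterate_eq hc m.2.1 l.2.2 m.2.2
      (lt_of_lt_of_le hj (hk m)) hjm.symm
    obtain rfl := Subtype.ext h1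
    omega
  · intro hi
    exact ⟨l, i, hi, rfl⟩

theorem card_legCut (h : T.IsRootedBy c p d) (hc : T.degree c ≠ 2)
    (hk : ∀ l, k l ≤ T.legLength p l) : (T.legCut c p k).card = ∑ l, k l := by
  have : T.legCut c p k = (Finset.univ.sigma fun l : T.Tip c => Finset.range (k l)).image
      fun x => p^[x.2] x.1 := by
    ext v
    simp [legCut]
  rw [this, Finset.card_image_of_injOn, Finset.card_sigma]
  · simp
  · rintro ⟨l, i⟩ hl ⟨m, j⟩ hm hij
    simp only [Finset.coe_sigma, Set.mem_sigma_iff, Finset.coe_range, Set.mem_Iio] at hl hm hij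
    obtain ⟨h1, h2⟩ := h.eq_of_iterate_eq hc m.2.1 l.2.2 m.2.2
      (lt_of_lt_of_le hm.2 (hk m)) hij
    obtain rfl := Subtype.ext h1
    obtain rfl := h2
    rfl

theorem legCut_injective (h : T.IsRootedBy c p d) (hc : T.degree c ≠ 2) {k' : T.Tip c → ℕ}
    (hk : ∀ l, k l ≤ T.legLength p l) (hk' : ∀ l, k' l ≤ T.legLength p l)
    (heq : T.legCut c p k = T.legCut c p k') : k = k' := by
  funext l
  have h1 := h.iterate_mem_legCut hc hk l
  have h2 := h.iterate_mem_legCut hc hk' l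
  rw [heq] at h1
  have h3 := (h1 (k l)).symm.trans (h2 (k l))
  have h4 := (h1 (k' l)).symm.trans (h2 (k' l))
  omega

theorem isTrunkLike_compl_legCut [Nontrivial V] (h : T.IsRootedBy c p d) (hc : T.degree c ≠ 2)
    (hk : ∀ l, k l ≤ T.legLength p l) : T.IsTrunkLike p (T.legCut c p k)ᶜ := by
  constructor
  · intro v hv
    rw [Finset.mem_compl]
    simp only [legCut, Finset.mem_filter, Finset.mem_univ, true_and]
    rintro ⟨l, i, hi, rfl⟩
    have := degree_iterate_le_two l.2.2 (lt_of_lt_of_le hi (hk l))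
    omega
  · intro v
    obtain ⟨l, i, rfl⟩ := h.exists_tip_iterate_eq v
    rw [← Function.iterate_succ_apply' p]
    simp only [Finset.mem_compl, h.iterate_mem_legCut hc hk]
    omega

end Cuts

/-- A set closed under parents meets each climb in a final segment, so the first index at which the
climb enters it serves as `k l`. This is at most the leg length, because the upper end of the leg is
the root or has degree at least `3`. -/
theorem exists_eq_compl_legCut (h : T.IsRootedBy c p d) (hc : 3 ≤ T.degree c)
    {s : Finset V} (hs : T.IsTrunkLike p s) :
    ∃ k : T.Tip c → ℕ, (∀ l, k l ≤ T.legLength p l) ∧ s = (T.legCut c p k)ᶜ := by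
  have hcs : c ∈ s := hs.mem_of_degree c hc
  have hc2 : T.degree c ≠ 2 := by omega
  have hex : ∀ l : T.Tip c, ∃ i, p^[i] (l : V) ∈ s := fun l => by
    obtain ⟨i, hi⟩ := h.exists_iterate_eq_root (l : V)
    exact ⟨i, by rwa [hi]⟩
  have hmem : ∀ (l : T.Tip c) i, p^[i] (l : V) ∈ s ↔ Nat.find (hex l) ≤ i := fun l i =>
    ⟨fun hi => Nat.find_min' _ hi, fun hi => hs.iterate_mem_of_le hi (Nat.find_spec (hex l))⟩
  have hle : ∀ l : T.Tip c, Nat.find (hex l) ≤ T.legLength p l := fun l => by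
    rw [← hmem]
    rcases h.iterate_legLength hc2 l.2.1 with h1 | h1
    · rwa [h1]
    · exact hs.mem_of_degree _ h1
  refine ⟨fun l => Nat.find (hex l), hle, ?_⟩
  have : Nontrivial V := by
    have hpos : 0 < T.degree c := by omega
    obtain ⟨u, hu⟩ := (T.degree_pos_iff_exists_adj c).mp hpos
    exact ⟨⟨c, u, hu.ne⟩⟩
  ext v
  obtain ⟨l, i, rfl⟩ := h.exists_tip_iterate_eq v
  rw [Finset.mem_compl, h.iterate_mem_legCut hc2 hle, hmem, not_lt]

theorem trunk_eq (h : T.IsRootedBy c p d) (hc : 3 ≤ T.degree c) :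
    T.trunk = ((T.legCut c p fun l => T.legLength p l)ᶜ : Finset V) := by
  have hc2 : T.degree c ≠ 2 := by omega
  have : Nontrivial V := by
    have hpos : 0 < T.degree c := by omega
    obtain ⟨u, hu⟩ := (T.degree_pos_iff_exists_adj c).mp hpos
    exact ⟨⟨c, u, hu.ne⟩⟩
  obtain ⟨a, ha⟩ : ∃ a : T.Tip c → ℕ, a = fun l : T.Tip c => T.legLength p l :=
    ⟨_, rfl⟩
  rw [← ha]
  have hle : ∀ l : T.Tip c, a l ≤ T.legLength p l := fun l => (congrFun ha l).le
  apply subset_antisymm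
  · have h1 := h.isTrunkLike_compl_legCut hc2 hle
    refine Set.sInter_subset_of_mem ⟨?_, h1.mem_of_degree⟩
    exact (h.preconnected_induce_iff (h1.mem_of_degree c hc)).mpr h1.parent_mem
  · rintro v hv s ⟨hs, hds⟩
    have h1 : T.IsTrunkLike p s.toFinset := by
      have h2 := (h.preconnected_induce_iff (hds c hc)).mp hs
      exact ⟨fun v hv => Set.mem_toFinset.mpr (hds v hv),
        fun v hv => Set.mem_toFinset.mpr (h2 v (Set.mem_toFinset.mp hv))⟩
    obtain ⟨k, hk, hsk⟩ := h.exists_eq_compl_legCut hc h1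
    rw [← Set.mem_toFinset, hsk, Finset.mem_compl]
    rw [Finset.mem_coe, Finset.mem_compl] at hv
    obtain ⟨l, i, rfl⟩ := h.exists_tip_iterate_eq v
    rw [h.iterate_mem_legCut hc2 hk]
    rw [h.iterate_mem_legCut hc2 hle, congrFun ha l] at hv
    exact fun hi => hv (hi.trans_le (hk l))

theorem ncard_trunk_add (h : T.IsRootedBy c p d) (hc : 3 ≤ T.degree c) :
    T.trunk.ncard + ∑ l : T.Tip c, T.legLength p l = Fintype.card V := by
  rw [h.trunk_eq hc, Set.ncard_coe_finset, ← h.card_legCut (by omega) fun l => le_rfl,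
    Finset.card_compl_add_card]

open Polynomial in
/-- The generating function of the trunk-like sets with a property that can be read off from the
lengths of the parts of the legs that have been cut off. -/
theorem sum_X_pow_card_compl [Nontrivial V] (h : T.IsRootedBy c p d) (hc : 3 ≤ T.degree c)
    {S : Finset (Finset V)} {Q : Finset V → Prop} (hS : ∀ s, s ∈ S ↔ T.IsTrunkLike p s ∧ Q s)
    (I : T.Tip c → Finset ℕ)
    (hI : ∀ l, ∀ i ∈ I l, i ≤ T.legLength p l)
    (hQ : ∀ k : T.Tip c → ℕ, (∀ l, k l ≤ T.legLength p l) →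
      (Q (T.legCut c p k)ᶜ ↔ ∀ l, k l ∈ I l)) :
    ∑ s ∈ S, (X : ℤ[X]) ^ sᶜ.card =
      ∏ l, ∑ i ∈ I l, (X : ℤ[X]) ^ i := by
  have hc2 : T.degree c ≠ 2 := by omega
  -- The expanded product has one term for each choice of cut lengths `k`.
  rw [Finset.prod_univ_sum]
  symm
  have hle : ∀ k ∈ Fintype.piFinset I, ∀ l, k l ≤ T.legLength p l := fun k hk l =>
    hI l _ (Fintype.mem_piFinset.mp hk l)
  refine Finset.sum_bij (fun k _ => (T.legCut c p k)ᶜ) ?_ ?_ ?_ ?_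
  · intro k hk
    exact (hS _).mpr ⟨h.isTrunkLike_compl_legCut hc2 (hle k hk),
      (hQ k (hle k hk)).mpr (Fintype.mem_piFinset.mp hk)⟩
  · intro k hk k' hk' heq
    exact h.legCut_injective hc2 (hle k hk) (hle k' hk') (compl_injective heq)
  · intro s hs
    rw [hS] at hs
    obtain ⟨k, hk, rfl⟩ := h.exists_eq_compl_legCut hc hs.1
    exact ⟨k, Fintype.mem_piFinset.mpr ((hQ k hk).mp hs.2), rfl⟩
  · intro k hk
    rw [compl_compl, h.card_legCut hc2 (hle k hk), Finset.prod_pow_eq_pow_sum]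

/-- No leaf remains if and only if something is cut off from every leg. -/
theorem compl_legCut_leafless_iff (h : T.IsRootedBy c p d) (hc : 3 ≤ T.degree c)
    {k : T.Tip c → ℕ} (hk : ∀ l, k l ≤ T.legLength p l) :
    (∀ v ∈ (T.legCut c p k)ᶜ, T.degree v ≠ 1) ↔
      ∀ l : T.Tip c, k l ∈ Finset.Icc 1 (T.legLength p l) := by
  have hc2 : T.degree c ≠ 2 := by omega
  have hmem := h.iterate_mem_legCut hc2 hk
  constructor
  · intro hs l
    rw [Finset.mem_Icc]
    refine ⟨?_, hk l⟩
    by_contra h0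
    refine hs (l : V) ?_ l.2.2
    rw [Finset.mem_compl]
    intro hl
    have := (hmem l 0).mp hl
    omega
  · intro hs v hv hd
    have hvc : v ≠ c := by
      rintro rfl
      omega
    rw [Finset.mem_compl] at hv
    apply hv
    exact (hmem ⟨v, hvc, hd⟩ 0).mpr (Finset.mem_Icc.mp (hs _)).1

/-- All neighbours of vertices of degree at least `3` remain if and only if no leg is cut off
completely. -/
theorem compl_legCut_neighbors_iff [Nontrivial V] (h : T.IsRootedBy c p d) (hc : 3 ≤ T.degree c)
    {k : T.Tip c → ℕ} (hk : ∀ l, k l ≤ T.legLength p l) :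
    (∀ u v, 3 ≤ T.degree v → T.Adj u v → u ∈ (T.legCut c p k)ᶜ) ↔
      ∀ l : T.Tip c, k l ∈ Finset.range (T.legLength p l) := by
  have hc2 : T.degree c ≠ 2 := by omega
  have hmem := h.iterate_mem_legCut hc2 hk
  constructor
  · intro hs l
    rw [Finset.mem_range]
    by_contra hkl
    have ha := (h.legLength_spec hc2 l.2.1).1
    have hadj := h.adj_parent (iterate_ne_root (p := p) hc2 l.2.1
      (show T.legLength p l - 1 < T.legLength p l by omega))
    rw [← Function.iterate_succ_apply' p, Nat.succ_eq_add_one, Nat.sub_add_cancel ha] at hadj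
    have hd : 3 ≤ T.degree (p^[T.legLength p l] (l : V)) := by
      rcases h.iterate_legLength hc2 l.2.1 with h1 | h1
      · rwa [h1]
      · exact h1
    have := hs _ _ hd hadj
    rw [Finset.mem_compl, hmem] at this
    omega
  · intro hs u v hd hadj
    have htl := h.isTrunkLike_compl_legCut hc2 hk
    rcases ((h.adj_iff _ _).mp hadj).2 with h1 | h1
    · subst h1
      obtain ⟨l, i, rfl⟩ := h.exists_tip_iterate_eq u
      rw [Finset.mem_compl, hmem]
      intro hi
      rw [← Function.iterate_succ_apply' p] at hd
      have h2 := Finset.mem_range.mp (hs l)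
      have := degree_iterate_le_two (p := p) l.2.2 (show i.succ < T.legLength p l by omega)
      omega
    · rw [← h1]
      exact htl.parent_mem v (htl.mem_of_degree v hd)

end IsRootedBy

end Legs

end SimpleGraph
namespace SimpleGraph

/-! ### Recovering a multiset of exponent pairs from a sum of monomials -/

section MonomialSums

theorem coeff_sum_monomial_pair {R ι : Type*} [CommSemiring R] (s : Finset ι) (f : ι → ℕ × ℕ)
    (x : ℕ × ℕ) :
    (∑ i ∈ s, (MvPolynomial.X 0 ^ (f i).1 * MvPolynomial.X 1 ^ (f i).2 :
      MvPolynomial (Fin 2) R)).coeff (Finsupp.single 0 x.1 + Finsupp.single 1 x.2) =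
      ((s.val.map f).count x : R) := by
  classical
  rw [MvPolynomial.coeff_sum, Multiset.count_map, ← Finset.filter_val, Finset.card_val,
    Finset.card_filter]
  push_cast
  refine Finset.sum_congr rfl fun i _ => ?_
  rw [MvPolynomial.X_pow_eq_monomial, MvPolynomial.X_pow_eq_monomial, MvPolynomial.monomial_mul,
    one_mul, MvPolynomial.coeff_monomial]
  refine if_congr ?_ rfl rfl
  constructor
  · intro h
    have h0 := DFunLike.congr_fun h 0
    have h1 := DFunLike.congr_fun h 1
    simp at h0 h1
    exact Prod.ext h0.symm h1.symm
  · intro h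
    rw [h]

theorem map_eq_of_sum_monomial_eq {R ι κ : Type*} [CommSemiring R] [CharZero R] {s : Finset ι}
    {t : Finset κ} {f : ι → ℕ × ℕ} {g : κ → ℕ × ℕ}
    (h : ∑ i ∈ s, (MvPolynomial.X 0 ^ (f i).1 * MvPolynomial.X 1 ^ (f i).2 :
        MvPolynomial (Fin 2) R) =
      ∑ j ∈ t, MvPolynomial.X 0 ^ (g j).1 * MvPolynomial.X 1 ^ (g j).2) :
    s.val.map f = t.val.map g := by
  ext x
  have := congrArg
    (MvPolynomial.coeff (Finsupp.single (0 : Fin 2) x.1 + Finsupp.single 1 x.2)) h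
  rw [coeff_sum_monomial_pair, coeff_sum_monomial_pair] at this
  exact_mod_cast this

end MonomialSums

/-! ### Recovering exponents from products of cyclotomic type -/

section CyclotomicProducts

open Polynomial

/-- Both sides vanish at a primitive `a`-th root of unity. -/
theorem exists_dvd_of_prod_X_pow_sub_one_eq {s t : Multiset ℕ} (hs : ∀ a ∈ s, 1 ≤ a)
    (h : (s.map fun a => (X ^ a - 1 : ℤ[X])).prod = (t.map fun a => (X ^ a - 1 : ℤ[X])).prod)
    {a : ℕ} (ha : a ∈ s) : ∃ b ∈ t, a ∣ b := by
  have hz := Complex.isPrimitiveRoot_exp a (by have := hs a ha; omega)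
  have h1 := congrArg (aeval (Complex.exp (2 * Real.pi * Complex.I / a))) h
  simp only [map_multiset_prod, Multiset.map_map, Function.comp_def, map_sub, map_pow, aeval_X,
    map_one] at h1
  rw [Multiset.prod_eq_zero] at h1
  · obtain ⟨b, hb, hb0⟩ := Multiset.mem_map.mp (Multiset.prod_eq_zero_iff.mp h1.symm)
    exact ⟨b, hb, hz.dvd_of_pow_eq_one b (sub_eq_zero.mp hb0)⟩
  · exact Multiset.mem_map.mpr ⟨a, ha, by rw [hz.pow_eq_one, sub_self]⟩

/-- The largest `a` in `s` divides some `b` in `t`, which divides some `e ≤ a` in `s`; hence `b =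
a`, and this factor can be cancelled. -/
theorem multiset_eq_of_prod_X_pow_sub_one_eq {s t : Multiset ℕ} (hs : ∀ a ∈ s, 1 ≤ a)
    (ht : ∀ a ∈ t, 1 ≤ a)
    (h : (s.map fun a => (X ^ a - 1 : ℤ[X])).prod = (t.map fun a => (X ^ a - 1 : ℤ[X])).prod) :
    s = t := by
  induction hn : Multiset.card s generalizing s t with
  | zero =>
    obtain rfl := Multiset.card_eq_zero.mp hn
    symm
    rw [Multiset.eq_zero_iff_forall_notMem]
    intro a ha
    obtain ⟨b, hb, -⟩ := exists_dvd_of_prod_X_pow_sub_one_eq ht h.symm ha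
    simp at hb
  | succ n ih =>
    have hne : s ≠ 0 := by
      rintro rfl
      simp at hn
    have hmem : ∃ a ∈ s, ∀ b ∈ s, b ≤ a := by
      obtain ⟨a, ha, hmax⟩ := Finset.exists_max_image s.toFinset id
        (Multiset.toFinset_nonempty.mpr hne)
      exact ⟨a, Multiset.mem_toFinset.mp ha, fun b hb => hmax b (Multiset.mem_toFinset.mpr hb)⟩
    obtain ⟨a, ha, hmax⟩ := hmem
    obtain ⟨b, hb, hab⟩ := exists_dvd_of_prod_X_pow_sub_one_eq hs h ha
    obtain ⟨e, he, hbe⟩ := exists_dvd_of_prod_X_pow_sub_one_eq ht h.symm hb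
    have hbe' : b = a := by
      have h1 := Nat.le_of_dvd (ht b hb) hab
      have h2 := Nat.le_of_dvd (hs e he) hbe
      have h3 := hmax e he
      omega
    subst hbe'
    obtain ⟨s', rfl⟩ := Multiset.exists_cons_of_mem ha
    obtain ⟨t', rfl⟩ := Multiset.exists_cons_of_mem hb
    simp only [Multiset.map_cons, Multiset.prod_cons] at h
    rw [ih (fun x hx => hs x (Multiset.mem_cons_of_mem hx))
      (fun x hx => ht x (Multiset.mem_cons_of_mem hx))
      (mul_left_cancel₀ (X_pow_sub_C_ne_zero (hs b ha) (1 : ℤ)) h) (by simpa using hn)]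

/-- Equal cardinalities are essential: an entry `1` contributes the factor `1` and is invisible in
the product. -/
theorem multiset_eq_of_prod_geom_sum_eq {s t : Multiset ℕ} (hs : ∀ a ∈ s, 1 ≤ a)
    (ht : ∀ a ∈ t, 1 ≤ a) (hcard : Multiset.card s = Multiset.card t)
    (h : (s.map fun a => ∑ i ∈ Finset.range a, (X : ℤ[X]) ^ i).prod =
      (t.map fun a => ∑ i ∈ Finset.range a, (X : ℤ[X]) ^ i).prod) : s = t := by
  refine multiset_eq_of_prod_X_pow_sub_one_eq hs ht ?_
  simp_rw [← geom_sum_mul]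
  rw [Multiset.prod_map_mul, Multiset.prod_map_mul, h]
  simp [hcard]

end CyclotomicProducts

end SimpleGraph
namespace SimpleGraph

/-! ### Twigs are legs -/

section Twigs

open scoped Classical

theorem Walk.mem_edges_iff_exists_getVert {V : Type*} {G : SimpleGraph V} {u v : V}
    (q : G.Walk u v) (e : Sym2 V) :
    e ∈ q.edges ↔ ∃ i < q.length, e = s(q.getVert i, q.getVert (i + 1)) := by
  induction q with
  | nil => simp
  | @cons u v w h q ih =>
    rw [Walk.edges_cons, List.mem_cons, ih, Walk.length_cons]
    constructor
    · rintro (rfl | ⟨i, hi, rfl⟩)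
      · exact ⟨0, by omega, by simp⟩
      · exact ⟨i + 1, by omega, by simp⟩
    · rintro ⟨i, hi, rfl⟩
      cases i with
      | zero => left; simp
      | succ i => exact Or.inr ⟨i, by omega, by simp⟩

/-- The depth bound on the support keeps the induction going: it prevents the climb from returning
to its start. -/
theorem IsRootedBy.exists_walk_iterate {V : Type*} {T : SimpleGraph V} {c : V} {p : V → V}
    {d : V → ℕ} (h : T.IsRootedBy c p d) (n : ℕ)
    (v : V) (hv : ∀ i < n, p^[i] v ≠ c) :
    ∃ (x : V) (w : T.Walk v x), w.length = n ∧ (∀ i ≤ n, w.getVert i = p^[i] v) ∧ w.IsPath ∧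
      ∀ x ∈ w.support, d x ≤ d v := by
  induction n generalizing v with
  | zero => exact ⟨v, Walk.nil, by simp⟩
  | succ n ih =>
    have hv0 : v ≠ c := hv 0 (by omega)
    obtain ⟨x, w, h1, h2, h3, h4⟩ := ih (p v) fun i hi => by
      rw [← Function.iterate_succ_apply]
      exact hv (i + 1) (by omega)
    have hd := h.depth v hv0
    refine ⟨x, Walk.cons (h.adj_parent hv0) w, by simp [h1], ?_, ?_, ?_⟩
    · intro i hi
      cases i with
      | zero => simp
      | succ i =>
        rw [Walk.getVert_cons_succ, h2 i (by omega), Function.iterate_succ_apply]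
    · refine h3.cons fun hmem => ?_
      have := h4 v hmem
      omega
    · intro x hx
      rw [Walk.support_cons, List.mem_cons] at hx
      rcases hx with rfl | hx
      · exact le_rfl
      · exact (h4 x hx).trans (by omega)

variable {V : Type*} [Fintype V] {T : SimpleGraph V}

theorem IsBarePath.reverse {u v : V} {q : T.Walk u v} (hq : T.IsBarePath q) :
    T.IsBarePath q.reverse := by
  obtain ⟨h1, h2, h3⟩ := hq
  refine ⟨h1.reverse, by simpa using h2, fun w hw hv hu => h3 w (by simpa using hw) hu hv⟩

theorem IsTwigOf.reverse {l u v : V} {q : T.Walk u v} (hq : T.IsTwigOf l q) :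
    T.IsTwigOf l q.reverse := by
  obtain ⟨h1, h2, h3⟩ := hq
  exact ⟨h1.reverse, by simpa using h2, fun u' v' q' h4 h5 => by simpa using h3 u' v' q' h4 h5⟩

theorem IsBarePath.eq_or_eq_of_degree_eq_one {l u v : V} {q : T.Walk u v} (hq : T.IsBarePath q)
    (hl : l ∈ q.support) (hd : T.degree l = 1) : l = u ∨ l = v := by
  by_contra hne
  push Not at hne
  exact absurd (hd.symm.trans (hq.2.2 l hl hne.1 hne.2)) (by norm_num)

variable {c : V} {p : V → V} {d : V → ℕ}

/-- The edges on the way from the leaf `l` to the first vertex whose degree is not `2`. -/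
noncomputable def legEdges (T : SimpleGraph V) (p : V → V) (l : V) : Finset (Sym2 V) :=
  (Finset.range (T.legLength p l)).image fun i => s(p^[i] l, p^[i + 1] l)

namespace IsRootedBy

theorem edges_toFinset_of_getVert {l u v : V} (q : T.Walk u v)
    (hlen : q.length = T.legLength p l) (hget : ∀ i ≤ q.length, q.getVert i = p^[i] l) :
    q.edges.toFinset = T.legEdges p l := by
  ext e
  rw [List.mem_toFinset, Walk.mem_edges_iff_exists_getVert, legEdges, Finset.mem_image]
  constructor
  · rintro ⟨i, hi, rfl⟩
    exact ⟨i, Finset.mem_range.mpr (by omega), by rw [hget i (by omega), hget (i + 1) (by omega)]⟩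
  · rintro ⟨i, hi, rfl⟩
    have := Finset.mem_range.mp hi
    exact ⟨i, by omega, by rw [hget i (by omega), hget (i + 1) (by omega)]⟩

theorem exists_isBarePath (h : T.IsRootedBy c p d) (hc : T.degree c ≠ 2) {l : V} (hl : l ≠ c) :
    ∃ (v : V) (w : T.Walk l v), T.IsBarePath w ∧ w.length = T.legLength p l ∧
      w.edges.toFinset = T.legEdges p l := by
  obtain ⟨v, w, h1, h2, h3, -⟩ := h.exists_walk_iterate (T.legLength p l) l
    fun i hi => iterate_ne_root hc hl hi
  refine ⟨_, w, ⟨h3, ?_, ?_⟩, h1, edges_toFinset_of_getVert w h1 fun i hi => h2 i (by omega)⟩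
  · rw [h1]
    exact (h.legLength_spec hc hl).1
  · intro x hx hxl hxe
    obtain ⟨i, rfl, hi⟩ := Walk.mem_support_iff_exists_getVert.mp hx
    rw [h2 i (by omega)] at hxl hxe ⊢
    apply degree_iterate_eq_two
    · rcases Nat.eq_zero_or_pos i with rfl | h0
      · exact absurd rfl hxl
      · exact h0
    · rcases lt_or_eq_of_le hi with hi | hi
      · omega
      · rw [← h2 i (by omega), hi, Walk.getVert_length] at hxe
        exact absurd rfl hxe

/-- A bare path from a leaf must climb: the leaf has no child, and an interior vertex has only the
child from which the path has just come. -/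
theorem getVert_of_isBarePath (h : T.IsRootedBy c p d) (hc : T.degree c ≠ 2) {l v : V}
    (hl : l ≠ c) (hd : T.degree l = 1) {q : T.Walk l v} (hq : T.IsBarePath q) :
    ∀ i ≤ q.length, q.getVert i = p^[i] l := by
  obtain ⟨hpath, -, hint⟩ := hq
  have hinj := hpath.getVert_injOn
  have hdeg : ∀ i, 1 ≤ i → i < q.length → T.degree (q.getVert i) = 2 := by
    intro i h1 hi
    refine hint _ (q.getVert_mem_support i) ?_ ?_
    · intro heq
      have := hinj (x₁ := i) (x₂ := 0) (by simp; omega) (by simp) (by simpa using heq)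
      omega
    · intro heq
      have := hinj (x₁ := i) (x₂ := q.length) (by simp; omega) (by simp) (by simpa using heq)
      omega
  intro i
  induction i using Nat.strong_induction_on with
  | _ i ih =>
    intro hi
    cases i with
    | zero => simp
    | succ i =>
      have hi0 := ih i (by omega) (by omega)
      have hne : p^[i] l ≠ c := by
        rcases Nat.eq_zero_or_pos i with rfl | h0
        · exact hl
        · rw [← hi0]
          intro heq
          exact hc (heq ▸ hdeg i h0 (by omega))
      have hadj := q.adj_getVert_succ (i := i) (by omega)
      rw [Function.iterate_succ_apply']
      rw [hi0] at hadj
      rcases ((h.adj_iff _ _).mp hadj).2 with h1 | h1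
      · exact h1.symm
      · exfalso
        have hne' : q.getVert (i + 1) ≠ c := h.ne_root_of_parent_ne_root (h1 ▸ hne)
        rcases Nat.eq_zero_or_pos i with rfl | h0
        · exact h.parent_ne_of_degree_eq_one hl hd hne' h1
        · obtain ⟨j, rfl⟩ := Nat.exists_eq_add_of_le' h0
          have hd2 := hdeg (j + 1) h0 (by omega)
          rw [hi0] at hd2
          have hj := ih j (by omega) (by omega)
          have hne2 : p^[j] l ≠ c := by
            rw [Function.iterate_succ_apply'] at hne
            exact h.ne_root_of_parent_ne_root hne
          have heq := h.eq_of_parent_eq hne hd2.le hne' hne2 h1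
            (Function.iterate_succ_apply' p j l).symm
          rw [← hj] at heq
          have := hinj (x₁ := j + 1 + 1) (x₂ := j) (by simp; omega) (by simp; omega) heq
          omega

theorem length_le_of_isBarePath (h : T.IsRootedBy c p d) (hc : T.degree c ≠ 2) {l v : V}
    (hl : l ≠ c) (hd : T.degree l = 1) {q : T.Walk l v} (hq : T.IsBarePath q) :
    q.length ≤ T.legLength p l := by
  have hget := h.getVert_of_isBarePath hc hl hd hq
  obtain ⟨hpath, -, hint⟩ := hq
  by_contra hlt
  push Not at hlt
  obtain ⟨h1, h2⟩ := h.legLength_spec hc hl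
  rw [← hget _ hlt.le] at h2
  apply h2
  have hinj := hpath.getVert_injOn
  refine hint _ (q.getVert_mem_support _) ?_ ?_
  · intro heq
    have := hinj (x₁ := T.legLength p l) (x₂ := 0) (by simp; omega) (by simp) (by simpa using heq)
    omega
  · intro heq
    have := hinj (x₁ := T.legLength p l) (x₂ := q.length) (by simp; omega) (by simp)
      (by simpa using heq)
    omega

theorem exists_isTwigOf_iff (h : T.IsRootedBy c p d) (hc : T.degree c ≠ 2) {l : V}
    (hl : l ≠ c) (hd : T.degree l = 1) (E : Finset (Sym2 V)) :
    (∃ (u v : V) (q : T.Walk u v), T.IsTwigOf l q ∧ q.edges.toFinset = E) ↔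
      E = T.legEdges p l := by
  obtain ⟨x, w, hw, hwlen, hwE⟩ := h.exists_isBarePath hc hl
  constructor
  · have key : ∀ (v : V) (q : T.Walk l v), T.IsTwigOf l q → q.edges.toFinset = T.legEdges p l := by
      rintro v q ⟨h1, -, h3⟩
      refine edges_toFinset_of_getVert q ?_ (h.getVert_of_isBarePath hc hl hd h1)
      have := h3 _ _ w hw w.start_mem_support
      exact le_antisymm (h.length_le_of_isBarePath hc hl hd h1) (hwlen ▸ this)
    rintro ⟨u, v, q, hq, rfl⟩
    rcases hq.1.eq_or_eq_of_degree_eq_one hq.2.1 hd with rfl | rfl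
    · exact key v q hq
    · rw [← key u q.reverse hq.reverse]
      simp
  · rintro rfl
    refine ⟨l, x, w, ⟨hw, w.start_mem_support, ?_⟩, hwE⟩
    intro u v q hq hlq
    rw [hwlen]
    rcases hq.eq_or_eq_of_degree_eq_one hlq hd with rfl | rfl
    · exact h.length_le_of_isBarePath hc hl hd hq
    · rw [← Walk.length_reverse]
      exact h.length_le_of_isBarePath hc hl hd hq.reverse

theorem card_legEdges (h : T.IsRootedBy c p d) (hc : T.degree c ≠ 2) {l : V} (hl : l ≠ c) :
    (T.legEdges p l).card = T.legLength p l := by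
  obtain ⟨x, w, hw, hwlen, hwE⟩ := h.exists_isBarePath hc hl
  rw [← hwE, List.toFinset_card_of_nodup hw.1.isTrail.edges_nodup, Walk.length_edges, hwlen]

theorem legEdges_injective (h : T.IsRootedBy c p d) (hc : T.degree c ≠ 2) {l m : V}
    (hl : l ≠ c) (hm : m ≠ c) (hdl : T.degree l = 1) (hdm : T.degree m = 1)
    (heq : T.legEdges p l = T.legEdges p m) : l = m := by
  have hmem : s(p^[0] l, p^[0 + 1] l) ∈ T.legEdges p l :=
    Finset.mem_image.mpr ⟨0, Finset.mem_range.mpr (h.legLength_spec hc hl).1, rfl⟩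
  rw [heq, legEdges, Finset.mem_image] at hmem
  obtain ⟨i, hi, hie⟩ := hmem
  rw [Finset.mem_range] at hi
  have key : ∃ j ≤ T.legLength p m, p^[j] m = l := by
    rcases Sym2.eq_iff.mp hie with ⟨h1, -⟩ | ⟨-, h1⟩
    · exact ⟨i, hi.le, h1⟩
    · exact ⟨i + 1, hi, h1⟩
  obtain ⟨j, hj, hjl⟩ := key
  rcases lt_or_eq_of_le hj with hj | rfl
  · exact (h.eq_of_iterate_eq (i := 0) hc hm hdl hdm hj hjl.symm).1
  -- Here `l` would be the upper end of the leg of `m`, which is the root or has degree at least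
  -- `3`.
  · exfalso
    rcases h.iterate_legLength hc hm with h1 | h1
    · exact hl (hjl.symm.trans h1)
    · rw [hjl] at h1
      omega

theorem twigLengths_eq (h : T.IsRootedBy c p d) (hc : 3 ≤ T.degree c) :
    T.twigLengths = (Finset.univ : Finset (T.Tip c)).val.map
      fun l : T.Tip c => T.legLength p l := by
  have hc2 : T.degree c ≠ 2 := by omega
  have hne : ∀ l, T.degree l = 1 → l ≠ c := by
    rintro l hl rfl
    omega
  have htw : T.twigs = (Finset.univ : Finset (T.Tip c)).image
      fun l : T.Tip c => T.legEdges p l := by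
    ext E
    simp only [twigs, Finset.mem_filter, Finset.mem_univ, true_and, Finset.mem_image]
    constructor
    · rintro ⟨l, u, v, q, hd, hq⟩
      exact ⟨⟨l, hne l hd, hd⟩,
        ((h.exists_isTwigOf_iff hc2 (hne l hd) hd E).mp ⟨u, v, q, hq⟩).symm⟩
    · rintro ⟨l, rfl⟩
      obtain ⟨u, v, q, hq⟩ := (h.exists_isTwigOf_iff hc2 l.2.1 l.2.2 _).mpr rfl
      exact ⟨l, u, v, q, l.2.2, hq⟩
  rw [twigLengths, htw, Finset.image_val_of_injOn, Multiset.map_map]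
  · exact Multiset.map_congr rfl fun l _ => h.card_legEdges hc2 l.2.1
  · intro l _ m _ heq
    exact Subtype.ext (h.legEdges_injective hc2 l.2.1 m.2.1 l.2.2 m.2.2 heq)

end IsRootedBy

end Twigs

end SimpleGraph
namespace SimpleGraph

/-! ### Counting leaves, paths, and the common last step -/

section DegreeExcess

open scoped Classical

variable {V : Type*} [Fintype V] {T : SimpleGraph V}

/-- The sum of `deg v - 2` over all vertices `v` of degree at least `3`. -/
noncomputable def degreeExcess (T : SimpleGraph V) : ℕ := ∑ v, (T.degree v - 2)

theorem degreeExcess_eq_zero_iff : T.degreeExcess = 0 ↔ ∀ v, T.degree v ≤ 2 := by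
  simp [degreeExcess, Finset.sum_eq_zero_iff, Nat.sub_eq_zero_iff_le]

/-- The sum of `deg v - 2` over all vertices is `-2` by the handshake lemma, and leaves contribute
its only negative terms. -/
theorem IsTree.card_filter_degree_eq_one [Nontrivial V] (hT : T.IsTree) :
    (Finset.univ.filter fun v => T.degree v = 1).card = 2 + T.degreeExcess := by
  have h1 := T.sum_degrees_eq_twice_card_edges
  have h2 := hT.card_edgeFinset
  have h3 : ∀ v, T.degree v + (if T.degree v = 1 then 1 else 0) = 2 + (T.degree v - 2) := by
    intro v
    have := hT.preconnected.degree_pos_of_nontrivial v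
    split_ifs <;> omega
  have h4 := Finset.sum_congr (rfl : (Finset.univ : Finset V) = Finset.univ) fun v _ => h3 v
  rw [Finset.sum_add_distrib, Finset.sum_add_distrib, ← Finset.card_filter, Finset.sum_const,
    Finset.card_univ, smul_eq_mul] at h4
  rw [degreeExcess]
  omega

theorem IsTree.card_tip {c : V} (hT : T.IsTree) (hc : 3 ≤ T.degree c) :
    Fintype.card (T.Tip c) = 2 + T.degreeExcess := by
  have : Nontrivial V := by
    have hpos : 0 < T.degree c := by omega
    obtain ⟨u, hu⟩ := (T.degree_pos_iff_exists_adj c).mp hpos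
    exact ⟨⟨c, u, hu.ne⟩⟩
  rw [← hT.card_filter_degree_eq_one, Fintype.card_subtype]
  congr 1
  ext v
  simp only [Finset.mem_filter, Finset.mem_univ, true_and, and_iff_right_iff_imp]
  rintro hv rfl
  omega

theorem trunk_eq_empty (hT : ∀ v, T.degree v ≤ 2) : T.trunk = ∅ := by
  refine Set.subset_empty_iff.mp (Set.sInter_subset_of_mem ⟨?_, fun v hv => ?_⟩)
  · rintro ⟨x, hx⟩
    exact hx.elim
  · have := hT v
    omega

theorem IsTree.eq_tip_of_degree_le_two (hT : T.IsTree) (hd : ∀ v, T.degree v ≤ 2)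
    {c l m : V} (hcd : T.degree c = 1) (hl : l ≠ c) (hld : T.degree l = 1) (hm : m ≠ c)
    (hmd : T.degree m = 1) : l = m := by
  have : Nontrivial V := ⟨⟨l, c, hl⟩⟩
  have h1 := hT.card_filter_degree_eq_one
  rw [degreeExcess_eq_zero_iff.mpr hd] at h1
  by_contra hlm
  have h2 : ({c, l, m} : Finset V) ⊆ Finset.univ.filter fun v => T.degree v = 1 := by
    intro x hx
    simp only [Finset.mem_insert, Finset.mem_singleton] at hx
    rw [Finset.mem_filter]
    rcases hx with rfl | rfl | rfl <;> simpa
  have h3 := Finset.card_le_card h2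
  rw [Finset.card_eq_three.mpr ⟨c, l, m, hl.symm, hm.symm, hlm, rfl⟩] at h3
  omega

/-- In a path rooted at one end, the leg of the other end reaches all vertices. -/
theorem IsRootedBy.legLength_of_degree_le_two {c : V} {p : V → V} {d : V → ℕ}
    (h : T.IsRootedBy c p d) (hT : T.IsTree) (hd : ∀ v, T.degree v ≤ 2) (hcd : T.degree c = 1)
    {l : V} (hl : l ≠ c) (hld : T.degree l = 1) : T.legLength p l + 1 = Fintype.card V := by
  have hc2 : T.degree c ≠ 2 := by omega
  have : Nontrivial V := ⟨⟨l, c, hl⟩⟩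
  apply le_antisymm
  · rw [← h.card_legEdges hc2 hl, ← hT.card_edgeFinset, add_le_add_iff_right]
    obtain ⟨v, w, -, -, hE⟩ := h.exists_isBarePath hc2 hl
    rw [← hE]
    refine Finset.card_le_card fun e he => ?_
    rw [mem_edgeFinset]
    exact w.edges_subset_edgeSet (List.mem_toFinset.mp he)
  · have hend : p^[T.legLength p l] l = c := by
      rcases h.iterate_legLength hc2 hl with h1 | h1
      · exact h1
      · have := hd (p^[T.legLength p l] l)
        omega
    have hsub : (Finset.univ : Finset V) ⊆
        (Finset.range (T.legLength p l + 1)).image fun i => p^[i] l := by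
      intro v _
      obtain ⟨⟨m, hm, hmd⟩, i, rfl⟩ := h.exists_tip_iterate_eq v
      obtain rfl := hT.eq_tip_of_degree_le_two hd hcd hl hld hm hmd
      simp only [Finset.mem_image, Finset.mem_range]
      rcases Nat.lt_or_ge i (T.legLength p l + 1) with hi | hi
      · exact ⟨i, hi, rfl⟩
      · exact ⟨T.legLength p l, by omega,
          by rw [hend, h.iterate_eq_root_of_le hend (by omega)]⟩
    have := (Finset.card_le_card hsub).trans Finset.card_image_le
    rwa [Finset.card_range, Finset.card_univ] at this

/-- Rooted at the opposite end, each of the two leaves has the whole path as its leg, and the two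
coincide as edge sets. -/
theorem IsTree.twigLengths_of_degree_le_two [Nontrivial V] (hT : T.IsTree)
    (hd : ∀ v, T.degree v ≤ 2) : T.twigLengths = {Fintype.card V - 1} := by
  have key : ∀ l, T.degree l = 1 → ∀ E : Finset (Sym2 V),
      (∃ (u v : V) (q : T.Walk u v), T.IsTwigOf l q ∧ q.edges.toFinset = E) ↔
        E = T.edgeFinset := by
    intro l hld E
    obtain ⟨c, hcd, hl⟩ : ∃ c, T.degree c = 1 ∧ l ≠ c := by
      obtain ⟨u, v, huv, hu, hv⟩ := hT.exists_ne_and_degree_eq_one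
      rcases eq_or_ne l u with rfl | hlu
      · exact ⟨v, by convert hv, huv⟩
      · exact ⟨u, by convert hu, hlu⟩
    obtain ⟨p, d, h⟩ := hT.exists_isRootedBy c
    have hc2 : T.degree c ≠ 2 := by omega
    rw [h.exists_isTwigOf_iff hc2 hl hld]
    have hE : T.legEdges p l = T.edgeFinset := by
      apply Finset.eq_of_subset_of_card_le
      · obtain ⟨v, w, -, -, hE⟩ := h.exists_isBarePath hc2 hl
        rw [← hE]
        intro e he
        rw [mem_edgeFinset]
        exact w.edges_subset_edgeSet (List.mem_toFinset.mp he)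
      · have h1 := h.legLength_of_degree_le_two hT hd hcd hl hld
        have h2 := hT.card_edgeFinset
        rw [h.card_legEdges hc2 hl]
        omega
    rw [hE]
  have htw : T.twigs = {T.edgeFinset} := by
    ext E
    simp only [twigs, Finset.mem_filter, Finset.mem_univ, true_and, Finset.mem_singleton]
    constructor
    · rintro ⟨l, u, v, q, hld, hq⟩
      exact (key l hld E).mp ⟨u, v, q, hq⟩
    · intro hE
      obtain ⟨l, -, -, hl, -⟩ := hT.exists_ne_and_degree_eq_one
      have hl' : T.degree l = 1 := by convert hl
      obtain ⟨u, v, q, hq⟩ := (key l hl' E).mpr hE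
      exact ⟨l, u, v, q, hl', hq⟩
  have h2 := hT.card_edgeFinset
  rw [twigLengths, htw, Finset.singleton_val, Multiset.map_singleton]
  congr 1
  omega

theorem twigLengths_of_subsingleton [Subsingleton V] : T.twigLengths = 0 := by
  rw [twigLengths, Multiset.map_eq_zero, Finset.val_eq_zero, twigs, Finset.filter_eq_empty_iff]
  rintro E - ⟨l, u, v, q, hd, -⟩
  obtain ⟨w, hw⟩ := (T.degree_pos_iff_exists_adj l).mp (by omega)
  exact hw.ne (Subsingleton.elim _ _)

theorem degreeExcess_of_subsingleton [Subsingleton V] : T.degreeExcess = 0 := by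
  rw [degreeExcess_eq_zero_iff]
  intro v
  by_contra hd
  obtain ⟨w, hw⟩ := (T.degree_pos_iff_exists_adj v).mp (by omega)
  exact hw.ne (Subsingleton.elim _ _)

theorem exists_three_le_degree_iff : (∃ c, 3 ≤ T.degree c) ↔ 0 < T.degreeExcess := by
  rw [Nat.pos_iff_ne_zero, Ne, degreeExcess_eq_zero_iff]
  push Not
  rfl

open Polynomial in
/-- The generating polynomials of the legs determine the size of the trunk and the lengths of the
twigs. -/
theorem trunk_twigs_eq_of_prod_eq {W : Type*} [Fintype W] {T' : SimpleGraph W}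
    (hT : T.IsTree) (hT' : T'.IsTree) (hn : Fintype.card V = Fintype.card W)
    (hx : T.degreeExcess = T'.degreeExcess)
    (hprod : ∀ {c p d} {c' p' d'}, 3 ≤ T.degree c → T.IsRootedBy c p d → 3 ≤ T'.degree c' →
      T'.IsRootedBy c' p' d' →
      ∏ l : T.Tip c, ∑ i ∈ Finset.range (T.legLength p l), (X : ℤ[X]) ^ i =
        ∏ l : T'.Tip c', ∑ i ∈ Finset.range (T'.legLength p' l), (X : ℤ[X]) ^ i) :
    T.trunk.ncard = T'.trunk.ncard ∧ T.twigLengths = T'.twigLengths := by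
  rcases Nat.eq_zero_or_pos T.degreeExcess with h0 | h0
  · have hd := degreeExcess_eq_zero_iff.mp h0
    have hd' := degreeExcess_eq_zero_iff.mp (hx ▸ h0)
    rw [trunk_eq_empty hd, trunk_eq_empty hd']
    refine ⟨by simp, ?_⟩
    rcases subsingleton_or_nontrivial V with hV | hV
    · have : Subsingleton W := by
        rw [← Fintype.card_le_one_iff_subsingleton] at hV ⊢
        omega
      rw [twigLengths_of_subsingleton, twigLengths_of_subsingleton]
    · have : Nontrivial W := by
        rw [← Fintype.one_lt_card_iff_nontrivial] at hV ⊢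
        omega
      rw [hT.twigLengths_of_degree_le_two hd, hT'.twigLengths_of_degree_le_two hd', hn]
  · obtain ⟨c, hc⟩ := exists_three_le_degree_iff.mpr h0
    obtain ⟨c', hc'⟩ := exists_three_le_degree_iff.mpr (hx ▸ h0)
    obtain ⟨p, d, h⟩ := hT.exists_isRootedBy c
    obtain ⟨p', d', h'⟩ := hT'.exists_isRootedBy c'
    have heq : T.twigLengths = T'.twigLengths := by
      rw [h.twigLengths_eq hc, h'.twigLengths_eq hc']
      apply multiset_eq_of_prod_geom_sum_eq
      · intro a ha
        obtain ⟨l, -, rfl⟩ := Multiset.mem_map.mp ha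
        exact (h.legLength_spec (by omega) l.2.1).1
      · intro a ha
        obtain ⟨l, -, rfl⟩ := Multiset.mem_map.mp ha
        exact (h'.legLength_spec (by omega) l.2.1).1
      · rw [Multiset.card_map, Multiset.card_map, Finset.card_val, Finset.card_val,
          Finset.card_univ, Finset.card_univ, hT.card_tip hc, hT'.card_tip hc', hx]
      · rw [Multiset.map_map, Multiset.map_map]
        exact hprod hc h hc' h'
    refine ⟨?_, heq⟩
    have h1 := h.ncard_trunk_add hc
    have h2 := h'.ncard_trunk_add hc'
    rw [h.twigLengths_eq hc, h'.twigLengths_eq hc'] at heq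
    have h3 := congrArg Multiset.sum heq
    change ∑ l : T.Tip c, T.legLength p l = ∑ l : T'.Tip c', T'.legLength p' l at h3
    omega

end DegreeExcess

end SimpleGraph
namespace SimpleGraph

/-! ### The subtree polynomial -/

section Subtrees

open scoped Classical

variable {V : Type*} {T : SimpleGraph V}

/-- The number of edges and the number of leaves of the subgraph induced by `s`. -/
noncomputable def edgesLeaves (T : SimpleGraph V) (s : Finset V) : ℕ × ℕ :=
  ((T.induce (s : Set V)).edgeFinset.card,
    (Finset.univ.filter fun x => (T.induce (s : Set V)).degree x = 1).card)

theorem IsSubtree.nontrivial {s : Finset V} (hs : T.IsSubtree s) : Nontrivial (s : Set V) := by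
  obtain ⟨e, he⟩ := hs.2
  induction e with
  | _ x y => exact ⟨⟨x, y, Adj.ne (show (T.induce (s : Set V)).Adj x y from he)⟩⟩

theorem IsSubtree.card_edges_add_one (hT : T.IsTree) {s : Finset V} (hs : T.IsSubtree s) :
    (T.edgesLeaves s).1 + 1 = s.card := by
  have h : (T.induce (s : Set V)).IsTree := ⟨hs.1, hT.isAcyclic.induce _⟩
  have h1 := h.card_edgeFinset
  rw [edgesLeaves]
  convert h1
  simp

variable [Fintype V]

theorem map_edgesLeaves_eq_of_subtreePolynomial_eq {W : Type*} [Fintype W] {T' : SimpleGraph W}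
    (h : T.subtreePolynomial = T'.subtreePolynomial) :
    (Finset.univ.filter fun s => T.IsSubtree s).val.map T.edgesLeaves =
      (Finset.univ.filter fun s => T'.IsSubtree s).val.map T'.edgesLeaves :=
  map_eq_of_sum_monomial_eq (R := ℤ) h

theorem degree_induce_coe (T : SimpleGraph V) (s : Finset V) (x : (s : Set V)) :
    (T.induce (s : Set V)).degree x = (T.neighborFinset x ∩ s).card := by
  rw [← card_neighborFinset_eq_degree]
  refine Finset.card_bij (fun y _ => (y : V)) ?_ ?_ ?_
  · intro y hy
    rw [mem_neighborFinset] at hy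
    rw [Finset.mem_inter, mem_neighborFinset]
    exact ⟨hy, y.2⟩
  · intro y _ z _ hyz
    exact Subtype.ext hyz
  · intro y hy
    rw [Finset.mem_inter, mem_neighborFinset] at hy
    exact ⟨⟨y, hy.2⟩, by rw [mem_neighborFinset]; exact hy.1, rfl⟩

/-- The leaf count for trees, applied to the induced subtree. Its terms are bounded one by one by
those of `degreeExcess`. -/
theorem IsSubtree.card_leaves (hT : T.IsTree) {s : Finset V} (hs : T.IsSubtree s) :
    (T.edgesLeaves s).2 =
      2 + ∑ v, if v ∈ s then (T.neighborFinset v ∩ s).card - 2 else 0 := by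
  have h : (T.induce (s : Set V)).IsTree := ⟨hs.1, hT.isAcyclic.induce _⟩
  have := hs.nontrivial
  have h1 := h.card_filter_degree_eq_one
  rw [degreeExcess] at h1
  rw [edgesLeaves]
  refine Eq.trans (by convert rfl) (h1.trans ?_)
  congr 1
  rw [← Finset.sum_filter, Finset.filter_mem_eq_inter, Finset.univ_inter,
    Finset.sum_subtype s (p := (· ∈ (s : Set V))) fun x => Iff.rfl]
  refine Finset.sum_congr (by convert rfl) fun x _ => ?_
  rw [← degree_induce_coe]
  convert rfl

theorem inner_degree_le (s : Finset V) (v : V) :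
    (if v ∈ s then (T.neighborFinset v ∩ s).card - 2 else 0) ≤ T.degree v - 2 := by
  split_ifs
  · rw [← card_neighborFinset_eq_degree]
    have := Finset.card_le_card (Finset.inter_subset_left : T.neighborFinset v ∩ s ⊆ _)
    omega
  · omega

theorem IsSubtree.card_leaves_le (hT : T.IsTree) {s : Finset V} (hs : T.IsSubtree s) :
    (T.edgesLeaves s).2 ≤ 2 + T.degreeExcess := by
  rw [hs.card_leaves hT, degreeExcess]
  exact Nat.add_le_add_left (Finset.sum_le_sum fun v _ => inner_degree_le s v) 2

/-- A subtree has the maximal number of leaves if and only if it contains all vertices of degree at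
least `3` and their neighbours. -/
theorem IsSubtree.card_leaves_eq_iff (hT : T.IsTree) {s : Finset V} (hs : T.IsSubtree s) :
    (T.edgesLeaves s).2 = 2 + T.degreeExcess ↔
      ∀ v, 3 ≤ T.degree v → v ∈ s ∧ ∀ u, T.Adj u v → u ∈ s := by
  rw [hs.card_leaves hT, degreeExcess, add_right_inj,
    Finset.sum_eq_sum_iff_of_le fun v _ => inner_degree_le s v]
  refine forall_congr' fun v => ?_
  simp only [Finset.mem_univ, true_imp_iff]
  constructor
  · intro h hd
    split_ifs at h with hv
    · refine ⟨hv, fun u hu => ?_⟩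
      rw [← card_neighborFinset_eq_degree] at h hd
      have h1 := Finset.eq_of_subset_of_card_le
        (Finset.inter_subset_left : T.neighborFinset v ∩ s ⊆ _) (by omega)
      have h2 : u ∈ T.neighborFinset v := (mem_neighborFinset _ _ _).mpr hu.symm
      rw [← h1] at h2
      exact (Finset.mem_inter.mp h2).2
    · omega
  · intro h
    by_cases hd : 3 ≤ T.degree v
    · obtain ⟨hv, hu⟩ := h hd
      rw [if_pos hv, Finset.inter_eq_left.mpr, card_neighborFinset_eq_degree]
      intro u hu'
      exact hu u ((mem_neighborFinset _ _ _).mp hu').symm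
    · have := inner_degree_le (T := T) s v
      omega

theorem isSubtree_univ [Nontrivial V] (hT : T.IsTree) : T.IsSubtree Finset.univ := by
  have e : T.induce ((Finset.univ : Finset V) : Set V) ≃g T := by
    rw [Finset.coe_univ]
    exact induceUnivIso T
  refine ⟨e.connected_iff.mpr hT.connected, ?_⟩
  obtain ⟨v⟩ := hT.connected.nonempty
  have hpos := hT.preconnected.degree_pos_of_nontrivial v
  obtain ⟨u, hu⟩ := (T.degree_pos_iff_exists_adj v).mp hpos
  exact ⟨s(⟨v, by simp⟩, ⟨u, by simp⟩), hu⟩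

theorem isSubtree_and_card_leaves_iff (hT : T.IsTree) {c : V} {p : V → V} {d : V → ℕ}
    (h : T.IsRootedBy c p d) (hc : 3 ≤ T.degree c) (s : Finset V) :
    (T.IsSubtree s ∧ (T.edgesLeaves s).2 = 2 + T.degreeExcess) ↔
      (T.IsTrunkLike p s ∧ ∀ u v, 3 ≤ T.degree v → T.Adj u v → u ∈ s) := by
  constructor
  · rintro ⟨hs, hl⟩
    rw [hs.card_leaves_eq_iff hT] at hl
    refine ⟨⟨fun v hv => (hl v hv).1, fun v hv => ?_⟩, fun u v hv huv => (hl v hv).2 u huv⟩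
    exact (h.preconnected_induce_iff (s := (s : Set V)) (hl c hc).1).mp hs.1.preconnected v hv
  · rintro ⟨hs, hn⟩
    have hcs := hs.mem_of_degree c hc
    have hsub : T.IsSubtree s := by
      refine ⟨(connected_iff _).mpr ⟨(h.preconnected_induce_iff hcs).mpr hs.parent_mem,
        ⟨⟨c, hcs⟩⟩⟩, ?_⟩
      obtain ⟨u, hu⟩ := (T.degree_pos_iff_exists_adj c).mp (by omega)
      exact ⟨s(⟨c, hcs⟩, ⟨u, hn u c hc hu.symm⟩), hu⟩
    exact ⟨hsub, (hsub.card_leaves_eq_iff hT).mpr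
      fun v hv => ⟨hs.mem_of_degree v hv, fun u huv => hn u v hv huv⟩⟩

open Polynomial in
-- The left side depends only on the data recorded by `S_T`; its exponent is the number of omitted
-- vertices.
theorem sum_X_pow_maximal_subtrees (hT : T.IsTree) {c : V} {p : V → V} {d : V → ℕ}
    (h : T.IsRootedBy c p d) (hc : 3 ≤ T.degree c) :
    ((((Finset.univ.filter fun s => T.IsSubtree s).val.map T.edgesLeaves).filter
      fun x => x.2 = 2 + T.degreeExcess).map
        fun x => (X : ℤ[X]) ^ (Fintype.card V - (x.1 + 1))).sum =
      ∏ l : T.Tip c, ∑ i ∈ Finset.range (T.legLength p l), (X : ℤ[X]) ^ i := by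
  have : Nontrivial V := by
    obtain ⟨u, hu⟩ := (T.degree_pos_iff_exists_adj c).mp (by omega)
    exact ⟨⟨c, u, hu.ne⟩⟩
  have hS : ∀ s, s ∈ (Finset.univ.filter fun s =>
      T.IsSubtree s ∧ (T.edgesLeaves s).2 = 2 + T.degreeExcess) ↔
        T.IsTrunkLike p s ∧ ∀ u v, 3 ≤ T.degree v → T.Adj u v → u ∈ s := fun s => by
    simpa using isSubtree_and_card_leaves_iff hT h hc s
  rw [← h.sum_X_pow_card_compl hc hS _ (fun l i hi => (Finset.mem_range.mp hi).le)
    fun k hk => h.compl_legCut_neighbors_iff hc hk]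
  rw [Multiset.filter_map, Multiset.map_map, ← Finset.filter_val, Finset.filter_filter]
  refine Finset.sum_congr rfl fun s hs => ?_
  have h1 := ((Finset.mem_filter.mp hs).2).1.card_edges_add_one hT
  simp only [Function.comp_apply]
  rw [h1, Finset.card_compl]

/-- The edge and leaf numbers of the whole of `T` must be those of some subtree of `T'`. A single
vertex has no subtrees and is treated apart. -/
theorem card_and_degreeExcess_le_of_edgesLeaves_eq {W : Type*} [Fintype W] {T' : SimpleGraph W}
    (hT : T.IsTree) (hT' : T'.IsTree)
    (h : (Finset.univ.filter fun s => T.IsSubtree s).val.map T.edgesLeaves =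
      (Finset.univ.filter fun s => T'.IsSubtree s).val.map T'.edgesLeaves) :
    Fintype.card V ≤ Fintype.card W ∧ T.degreeExcess ≤ T'.degreeExcess := by
  rcases subsingleton_or_nontrivial V with hV | hV
  · refine ⟨?_, by rw [degreeExcess_of_subsingleton]; exact Nat.zero_le _⟩
    obtain ⟨w⟩ := hT'.connected.nonempty
    exact (Fintype.card_le_one_iff_subsingleton.mpr hV).trans (Fintype.card_pos_iff.mpr ⟨w⟩)
  · have hu := isSubtree_univ hT
    have hmem : T.edgesLeaves Finset.univ ∈
        (Finset.univ.filter fun s => T.IsSubtree s).val.map T.edgesLeaves :=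
      Multiset.mem_map_of_mem _ (Finset.mem_filter.mpr ⟨Finset.mem_univ _, hu⟩)
    rw [h] at hmem
    obtain ⟨s, hs, hse⟩ := Multiset.mem_map.mp hmem
    have hs' : T'.IsSubtree s := (Finset.mem_filter.mp hs).2
    have h1 := hu.card_edges_add_one hT
    have h2 := hs'.card_edges_add_one hT'
    have h3 := (hu.card_leaves_eq_iff hT).mpr fun v _ => by simp
    have h4 := hs'.card_leaves_le hT'
    have h5 := s.card_le_univ
    rw [hse] at h2 h4
    rw [Finset.card_univ] at h1
    omega

theorem trunk_twigs_eq_of_subtreePolynomial_eq {W : Type*} [Fintype W] {T' : SimpleGraph W}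
    (hT : T.IsTree) (hT' : T'.IsTree) (h : T.subtreePolynomial = T'.subtreePolynomial) :
    T.trunk.ncard = T'.trunk.ncard ∧ T.twigLengths = T'.twigLengths := by
  have hm := map_edgesLeaves_eq_of_subtreePolynomial_eq h
  obtain ⟨h1, h2⟩ := card_and_degreeExcess_le_of_edgesLeaves_eq hT hT' hm
  obtain ⟨h3, h4⟩ := card_and_degreeExcess_le_of_edgesLeaves_eq hT' hT hm.symm
  have hn := le_antisymm h1 h3
  have hx := le_antisymm h2 h4
  refine trunk_twigs_eq_of_prod_eq hT hT' hn hx fun hc hr hc' hr' => ?_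
  rw [← sum_X_pow_maximal_subtrees hT hr hc, ← sum_X_pow_maximal_subtrees hT' hr' hc', hm, hn, hx]

end Subtrees

end SimpleGraph
namespace SimpleGraph

/-! ### Counting colorings with two kinds of colors -/

section Colorings

open scoped Classical

variable {V : Type*} [Fintype V] {T : SimpleGraph V}

/-- The proper colorings of `T` with a finite type of colors, as functions. -/
noncomputable def properColorings (T : SimpleGraph V) (α : Type*) [Fintype α] : Finset (V → α) :=
  Finset.univ.filter fun f => ∀ u v, T.Adj u v → f u ≠ f v

theorem mem_properColorings {α : Type*} [Fintype α] (f : V → α) :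
    f ∈ T.properColorings α ↔ ∀ u v, T.Adj u v → f u ≠ f v := by
  simp [properColorings]

theorem count_monomials_properColorings {α : Type*} [Fintype α] (ι : α ↪ ℕ+) (m : α →₀ ℕ) :
    (((T.properColorings α).val.map fun f => ∑ v, Finsupp.single (f v) 1).count m : ℤ) =
      MvPowerSeries.coeff (m.mapDomain ι) T.chromaticSymmetricFunction := by
  rw [Multiset.count_map, ← Finset.filter_val, Finset.card_val]
  change _ = (({κ : T.Coloring ℕ+ | ∑ v, Finsupp.single (κ v) 1 = m.mapDomain ι}.ncard : ℕ) : ℤ)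
  rw [← Set.ncard_coe_finset]
  congr 1
  have hmap : ∀ f : V → α, ∑ v, Finsupp.single (ι (f v)) 1 =
      (∑ v, Finsupp.single (f v) (1 : ℕ)).mapDomain ι := by
    intro f
    rw [Finsupp.mapDomain_finsetSum]
    exact Finset.sum_congr rfl fun v _ => Finsupp.mapDomain_single.symm
  refine Set.ncard_congr (fun f hf => Coloring.mk (fun v => ι (f v)) ?_) ?_ ?_ ?_
  · intro u v huv heq
    have hf' := (mem_properColorings f).mp (Finset.mem_filter.mp hf).1
    exact hf' u v huv (ι.injective heq)
  · intro f hf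
    have hf' := (Finset.mem_filter.mp hf).2
    change ∑ v, Finsupp.single (ι (f v)) 1 = m.mapDomain ι
    rw [hmap, ← hf']
  · intro f g hf hg hfg
    funext v
    exact ι.injective (DFunLike.congr_fun hfg v)
  · intro κ hκ
    have hκ' : ∑ v, Finsupp.single (κ v) 1 = m.mapDomain ι := hκ
    -- A coloring with this monomial uses only colors in the range of `ι`.
    have hrange : ∀ v, ∃ a, ι a = κ v := by
      intro v
      have hv : κ v ∈ (m.mapDomain ι).support := by
        rw [← hκ', Finsupp.mem_support_iff, Finsupp.finsetSum_apply]
        intro h0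
        have := (Finset.sum_eq_zero_iff.mp h0) v (Finset.mem_univ v)
        simp at this
      obtain ⟨a, -, ha⟩ := Finset.mem_image.mp (Finsupp.mapDomain_support hv)
      exact ⟨a, ha⟩
    choose f hf using hrange
    refine ⟨f, ?_, ?_⟩
    · rw [Finset.mem_coe, Finset.mem_filter, mem_properColorings]
      refine ⟨fun u v huv heq => κ.valid huv ?_, ?_⟩
      · rw [← hf, ← hf, heq]
      · apply Finsupp.mapDomain_injective ι.injective
        rw [← hmap, ← hκ']
        simp_rw [hf]
    · exact DFunLike.ext _ _ hf

variable {W : Type*} [Fintype W] {T' : SimpleGraph W}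

theorem map_monomials_eq (h : T.chromaticSymmetricFunction = T'.chromaticSymmetricFunction)
    {α : Type*} [Fintype α] (ι : α ↪ ℕ+) :
    ((T.properColorings α).val.map fun f => ∑ v, Finsupp.single (f v) 1) =
      (T'.properColorings α).val.map fun f => ∑ v, Finsupp.single (f v) 1 := by
  ext m
  have h1 := count_monomials_properColorings (T := T) ι m
  rw [h, ← count_monomials_properColorings ι m] at h1
  exact_mod_cast h1

/-- An embedding of a finite type into the positive integers. -/
noncomputable def colorEmbedding (α : Type*) [Fintype α] : α ↪ ℕ+ :=
  (Fintype.equivFin α).toEmbedding.trans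
    ⟨fun i => i.val.succPNat, fun _ _ hij => Fin.ext (Nat.succPNat_injective hij)⟩

/-- Coloring each vertex by itself is proper, and the degree of its monomial is the number of
vertices. -/
theorem card_eq_of_chromaticSymmetricFunction_eq
    (h : T.chromaticSymmetricFunction = T'.chromaticSymmetricFunction) :
    Fintype.card V = Fintype.card W := by
  have hmem : ∑ v, Finsupp.single v 1 ∈
      (T.properColorings V).val.map fun f => ∑ v, Finsupp.single (f v) 1 :=
    Multiset.mem_map.mpr ⟨id, (mem_properColorings _).mpr fun u v huv => huv.ne, rfl⟩
  rw [map_monomials_eq h (colorEmbedding V)] at hmem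
  obtain ⟨f, -, hf⟩ := Multiset.mem_map.mp hmem
  have := congrArg Finsupp.degree hf
  simpa [map_sum] using this.symm

/-- The number of vertices with a color in the first part. -/
noncomputable def leftCount {α β : Type*} (f : V → α ⊕ β) : ℕ :=
  (Finset.univ.filter fun v => (f v).isLeft).card

theorem liftAddHom_sum_single {α β : Type*} (f : V → α ⊕ β) :
    Finsupp.liftAddHom (fun a : α ⊕ β => if a.isLeft then AddMonoidHom.id ℕ else 0)
      (∑ v, Finsupp.single (f v) 1) = leftCount f := by
  rw [map_sum, leftCount, Finset.card_filter]
  refine Finset.sum_congr rfl fun v _ => ?_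
  rw [Finsupp.liftAddHom_apply_single]
  split_ifs <;> rfl

theorem map_leftCount_eq (h : T.chromaticSymmetricFunction = T'.chromaticSymmetricFunction)
    (α β : Type*) [Fintype α] [Fintype β] :
    (T.properColorings (α ⊕ β)).val.map leftCount =
      (T'.properColorings (α ⊕ β)).val.map leftCount := by
  have h1 := congrArg (Multiset.map (Finsupp.liftAddHom
    fun a : α ⊕ β => if a.isLeft then AddMonoidHom.id ℕ else 0)) 
    (map_monomials_eq h (colorEmbedding (α ⊕ β)))
  rw [Multiset.map_map, Multiset.map_map] at h1
  simpa only [Function.comp_def, liftAddHom_sum_single] using h1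

/-- The color of a vertex relative to the color of its parent. -/
def relColor {A B : Type*} [Sub A] [Sub B] : A ⊕ B → A ⊕ B → A ⊕ B
  | Sum.inl a, Sum.inl b => Sum.inl (a - b)
  | Sum.inr a, Sum.inr b => Sum.inr (a - b)
  | Sum.inl a, Sum.inr _ => Sum.inl a
  | Sum.inr a, Sum.inl _ => Sum.inr a

section RelColor

variable {A B : Type*} [AddGroup A] [AddGroup B]

theorem isLeft_relColor (x y : A ⊕ B) : (relColor x y).isLeft = x.isLeft := by
  cases x <;> cases y <;> rfl

theorem relColor_left_injective (y : A ⊕ B) : Function.Injective fun x => relColor x y := by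
  intro x x' h
  cases x <;> cases x' <;> cases y <;> simp_all [relColor]

theorem relColor_ne_zero_iff (x y : A ⊕ B) (h : y.isLeft = x.isLeft) :
    (relColor x y ≠ Sum.inl 0 ∧ relColor x y ≠ Sum.inr 0) ↔ x ≠ y := by
  cases x <;> cases y <;> simp_all [relColor, sub_eq_zero]

theorem card_filter_sum_type [Fintype A] [Fintype B] (P Q : Prop) :
    (Finset.univ.filter fun z : A ⊕ B =>
      (z.isLeft = true ↔ P) ∧ (Q → z ≠ Sum.inl 0 ∧ z ≠ Sum.inr 0)).card =
      if P then (if Q then Fintype.card A - 1 else Fintype.card A)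
        else (if Q then Fintype.card B - 1 else Fintype.card B) := by
  have hA : (∑ a : A, if a = 0 then 0 else 1) = Fintype.card A - 1 := by
    rw [← Finset.card_univ, ← Finset.card_erase_of_mem (Finset.mem_univ (0 : A)),
      Finset.card_eq_sum_ones, ← Finset.filter_ne', Finset.sum_filter]
    simp
  have hB : (∑ b : B, if b = 0 then 0 else 1) = Fintype.card B - 1 := by
    rw [← Finset.card_univ, ← Finset.card_erase_of_mem (Finset.mem_univ (0 : B)),
      Finset.card_eq_sum_ones, ← Finset.filter_ne', Finset.sum_filter]
    simp
  rw [Finset.card_filter, Fintype.sum_sum_type]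
  by_cases hP : P <;> by_cases hQ : Q <;> simp [hP, hQ, hA, hB]

end RelColor

/-- The number of edges of the rooted tree that lie inside `s`. -/
noncomputable def insideEdges (c : V) (p : V → V) (s : Finset V) : ℕ :=
  (Finset.univ.filter fun v => v ∈ s ∧ v ≠ c ∧ p v ∈ s).card

namespace IsRootedBy

variable {c : V} {p : V → V} {d : V → ℕ} {A B : Type*} [AddGroup A] [AddGroup B]

/-- The colors can be recovered from the root downwards. -/
theorem relColor_bijective [Finite A] [Finite B] (h : T.IsRootedBy c p d) :
    Function.Bijective fun (f : V → A ⊕ B) v => if v = c then f v else relColor (f v) (f (p v)) := by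
  rw [← Finite.injective_iff_bijective]
  intro f g hfg
  funext v
  have hv := fun v => congrFun hfg v
  simp only at hv
  induction hn : d v generalizing v with
  | zero =>
    have hvc : v = c := by
      by_contra hvc
      have := h.depth v hvc
      omega
    simpa [hvc] using hv c
  | succ n ih =>
    by_cases hvc : v = c
    · simpa [hvc] using hv c
    · have h1 := hv v
      rw [if_neg hvc, if_neg hvc, ih (p v) (by have := h.depth v hvc; omega)] at h1
      exact relColor_left_injective _ h1

/-- In terms of relative colors, being proper with first part `s` is an independent condition at
each vertex: the side is prescribed, and zero is forbidden when the parent is on the same side. -/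
theorem card_properColorings_filter [Fintype A] [Fintype B] (h : T.IsRootedBy c p d)
    (s : Finset V) :
    ((T.properColorings (A ⊕ B)).filter fun f => ∀ v, (f v).isLeft = true ↔ v ∈ s).card =
      ∏ v, if v ∈ s then
        (if v ≠ c ∧ (p v ∈ s ↔ v ∈ s) then Fintype.card A - 1 else Fintype.card A)
        else (if v ≠ c ∧ (p v ∈ s ↔ v ∈ s) then Fintype.card B - 1 else Fintype.card B) := by
  have hbij := h.relColor_bijective (A := A) (B := B)
  have hleft : ∀ (f : V → A ⊕ B) v,
      ((if v = c then f v else relColor (f v) (f (p v))).isLeft) = (f v).isLeft := by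
    intro f v
    split_ifs
    · rfl
    · exact isLeft_relColor _ _
  have hiff : ∀ f : V → A ⊕ B, (f ∈ (T.properColorings (A ⊕ B)).filter fun f =>
      ∀ v, (f v).isLeft = true ↔ v ∈ s) ↔
      (fun v => if v = c then f v else relColor (f v) (f (p v))) ∈
        Fintype.piFinset fun v => Finset.univ.filter fun z : A ⊕ B =>
          (z.isLeft = true ↔ v ∈ s) ∧
            ((v ≠ c ∧ (p v ∈ s ↔ v ∈ s)) → z ≠ Sum.inl 0 ∧ z ≠ Sum.inr 0) := by
    intro f
    rw [Finset.mem_filter, mem_properColorings, Fintype.mem_piFinset]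
    simp only [Finset.mem_filter, Finset.mem_univ, true_and, hleft]
    constructor
    · rintro ⟨h1, h2⟩ v
      refine ⟨h2 v, ?_⟩
      rintro ⟨hvc, hp⟩
      rw [if_neg hvc]
      apply (relColor_ne_zero_iff _ _ _).mpr
      · exact h1 _ _ (h.adj_parent hvc)
      · rw [Bool.eq_iff_iff, h2, h2]
        exact hp
    · intro h1
      have h2 : ∀ v, (f v).isLeft = true ↔ v ∈ s := fun v => (h1 v).1
      have h3 : ∀ v, v ≠ c → f v ≠ f (p v) := by
        intro v hvc heq
        have hs : p v ∈ s ↔ v ∈ s := by rw [← h2, ← h2, heq]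
        have h4 := (h1 v).2 ⟨hvc, hs⟩
        rw [if_neg hvc] at h4
        exact (relColor_ne_zero_iff _ _ (by rw [heq])).mp h4 heq
      refine ⟨fun u v huv => ?_, h2⟩
      obtain ⟨hne, h4⟩ := (h.adj_iff _ _).mp huv
      rcases h4 with rfl | rfl
      · refine h3 u ?_
        rintro rfl
        exact hne h.root.symm
      · refine (h3 v ?_).symm
        rintro rfl
        exact hne h.root
  rw [Finset.card_bij (fun f _ v => if v = c then f v else relColor (f v) (f (p v)))
    (fun f hf => (hiff f).mp hf) (fun f _ g _ hfg => hbij.1 hfg)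
    (fun g hg => by
      obtain ⟨f, rfl⟩ := hbij.2 g
      exact ⟨f, (hiff f).mpr hg, rfl⟩), Fintype.card_piFinset]
  refine Finset.prod_congr rfl fun v _ => ?_
  convert card_filter_sum_type (A := A) (B := B) (v ∈ s) (v ≠ c ∧ (p v ∈ s ↔ v ∈ s))

/-- The number of proper colorings for which the vertices in `s` are exactly those with a color in
the first part. -/
theorem cast_card_properColorings_filter [Fintype A] [Fintype B] (h : T.IsRootedBy c p d)
    (s : Finset V) :
    (((T.properColorings (A ⊕ B)).filter fun f => ∀ v, (f v).isLeft = true ↔ v ∈ s).card : ℚ) =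
      (Fintype.card A : ℚ) ^ s.card * (Fintype.card B : ℚ) ^ sᶜ.card *
        ((((Fintype.card A : ℚ) - 1) / Fintype.card A) ^ insideEdges c p s *
          (((Fintype.card B : ℚ) - 1) / Fintype.card B) ^ insideEdges c p sᶜ) := by
  have hA : 1 ≤ Fintype.card A := Fintype.card_pos
  have hB : 1 ≤ Fintype.card B := Fintype.card_pos
  have hA' : (Fintype.card A : ℚ) ≠ 0 := by exact_mod_cast (by omega : Fintype.card A ≠ 0)
  have hB' : (Fintype.card B : ℚ) ≠ 0 := by exact_mod_cast (by omega : Fintype.card B ≠ 0)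
  rw [h.card_properColorings_filter, Nat.cast_prod]
  have h1 : ∀ v, (((if v ∈ s then
        (if v ≠ c ∧ (p v ∈ s ↔ v ∈ s) then Fintype.card A - 1 else Fintype.card A)
        else (if v ≠ c ∧ (p v ∈ s ↔ v ∈ s) then Fintype.card B - 1 else Fintype.card B) : ℕ)) : ℚ) =
      (if v ∈ s then (Fintype.card A : ℚ) else 1) * (if v ∈ sᶜ then (Fintype.card B : ℚ) else 1) *
      ((if v ∈ s ∧ v ≠ c ∧ p v ∈ s then ((Fintype.card A : ℚ) - 1) / Fintype.card A else 1) *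
      (if v ∈ sᶜ ∧ v ≠ c ∧ p v ∈ sᶜ then ((Fintype.card B : ℚ) - 1) / Fintype.card B else 1)) := by
    intro v
    rcases eq_or_ne v c with rfl | hc
    · by_cases hs : v ∈ s <;> simp [hs]
    · by_cases hs : v ∈ s <;> by_cases hp : p v ∈ s <;>
        simp [hs, hc, hp, Nat.cast_pred hA, Nat.cast_pred hB, mul_div_cancel₀, hA', hB']
  simp_rw [h1, Finset.prod_mul_distrib, Finset.prod_ite, Finset.prod_const, one_pow,
    mul_one]
  simp only [Finset.filter_mem_eq_inter, Finset.univ_inter, insideEdges]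

end IsRootedBy

end Colorings

end SimpleGraph
namespace SimpleGraph

/-! ### Inside edges and the chromatic symmetric function -/

section InsideEdges

open scoped Classical

variable {V : Type*} [Fintype V] {T : SimpleGraph V} {c : V} {p : V → V} {d : V → ℕ}

/-- The colorings are sorted by the set of vertices colored from the first part. Color numbers `k +
1` and `l + 1` make both parts nonempty groups. -/
theorem IsRootedBy.cast_count_leftCount (h : T.IsRootedBy c p d) (m k l : ℕ) :
    (((T.properColorings (Fin (k + 1) ⊕ Fin (l + 1))).val.map leftCount).count m : ℚ) =
      ((k + 1 : ℚ) ^ m * (l + 1 : ℚ) ^ (Fintype.card V - m)) *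
        ∑ s ∈ Finset.powersetCard m Finset.univ,
          (k / (k + 1) : ℚ) ^ insideEdges c p s * (l / (l + 1) : ℚ) ^ insideEdges c p sᶜ := by
  rw [Multiset.count_map, ← Finset.filter_val, Finset.card_val,
    Finset.card_eq_sum_card_fiberwise (f := fun f => Finset.univ.filter fun v => (f v).isLeft)
      (t := Finset.powersetCard m Finset.univ), Nat.cast_sum, Finset.mul_sum]
  · refine Finset.sum_congr rfl fun s hs => ?_
    have hs' := (Finset.mem_powersetCard.mp hs).2
    have h1 := h.cast_card_properColorings_filter (A := Fin (k + 1)) (B := Fin (l + 1)) s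
    rw [Finset.card_compl, hs', Fintype.card_fin, Fintype.card_fin] at h1
    push_cast at h1
    rw [add_sub_cancel_right, add_sub_cancel_right] at h1
    rw [← h1]
    congr 2
    ext f
    simp only [Finset.mem_filter, Finset.ext_iff, Finset.mem_univ, true_and]
    constructor
    · rintro ⟨⟨h2, -⟩, h3⟩
      exact ⟨h2, h3⟩
    · rintro ⟨h2, h3⟩
      refine ⟨⟨h2, ?_⟩, h3⟩
      rw [← hs', leftCount]
      congr 1
      ext v
      simp [h3]
  · intro f hf
    have hf' := (Finset.mem_filter.mp hf).2
    rw [Finset.mem_coe, Finset.mem_powersetCard]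
    exact ⟨Finset.subset_univ _, hf'.symm⟩

variable {W : Type*} [Fintype W] {T' : SimpleGraph W} {c' : W} {p' : W → W} {d' : W → ℕ}

theorem infinite_range_div_add_one : (Set.range fun k : ℕ => (k / (k + 1) : ℚ)).Infinite := by
  refine Set.infinite_range_of_injective fun k l hkl => ?_
  have hk : (k + 1 : ℚ) ≠ 0 := by positivity
  have hl : (l + 1 : ℚ) ≠ 0 := by positivity
  rw [div_eq_div_iff hk hl] at hkl
  have : (k : ℚ) = l := by linarith
  exact_mod_cast this

theorem map_insideEdges_powersetCard_eq
    (hX : T.chromaticSymmetricFunction = T'.chromaticSymmetricFunction)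
    (h : T.IsRootedBy c p d) (h' : T'.IsRootedBy c' p' d') (m : ℕ) :
    (Finset.powersetCard m Finset.univ).val.map
        (fun s => (insideEdges c p s, insideEdges c p sᶜ)) =
      (Finset.powersetCard m Finset.univ).val.map
        fun s => (insideEdges c' p' s, insideEdges c' p' sᶜ) := by
  apply map_eq_of_sum_monomial_eq (R := ℚ)
  -- The counts give the values of both polynomials at all points `(k / (k + 1), l / (l + 1))`, up
  -- to a common nonzero factor; these points form a product of infinite sets.
  refine MvPolynomial.funext_set _ (fun _ : Fin 2 => infinite_range_div_add_one) fun x hx => ?_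
  obtain ⟨k, hk⟩ := hx 0 (Set.mem_univ _)
  obtain ⟨l, hl⟩ := hx 1 (Set.mem_univ _)
  simp only [map_sum, map_mul, map_pow, MvPolynomial.eval_X, ← hk, ← hl]
  have h1 := h.cast_count_leftCount m k l
  rw [map_leftCount_eq hX, h'.cast_count_leftCount m k l,
    card_eq_of_chromaticSymmetricFunction_eq hX] at h1
  exact (mul_left_cancel₀ (by positivity) h1).symm

theorem map_insideEdges_eq
    (hX : T.chromaticSymmetricFunction = T'.chromaticSymmetricFunction)
    (h : T.IsRootedBy c p d) (h' : T'.IsRootedBy c' p' d') :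
    (Finset.univ : Finset (Finset V)).val.map
        (fun s => (s.card, insideEdges c p s, insideEdges c p sᶜ)) =
      (Finset.univ : Finset (Finset W)).val.map
        fun s => (s.card, insideEdges c' p' s, insideEdges c' p' sᶜ) := by
  ext ⟨m, x⟩
  have h1 := congrArg (Multiset.count x) (map_insideEdges_powersetCard_eq hX h h' m)
  rw [Multiset.count_map, Multiset.count_map, ← Finset.filter_val, ← Finset.filter_val,
    ← Finset.univ_filter_card_eq, ← Finset.univ_filter_card_eq, Finset.filter_filter,
    Finset.filter_filter] at h1
  rw [Multiset.count_map, Multiset.count_map, ← Finset.filter_val, ← Finset.filter_val]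
  convert h1 using 6 <;> simp [Prod.ext_iff, eq_comm]

namespace IsRootedBy

/-- The degree sum counts edges inside `s` twice and edges leaving `s` once; the latter are
eliminated through the total number `n - 1` of edges. -/
theorem sum_degree_add (h : T.IsRootedBy c p d) (s : Finset V) :
    ∑ v ∈ s, T.degree v + insideEdges c p sᶜ + 1 = insideEdges c p s + Fintype.card V := by
  have h1 : ∑ v ∈ s, T.degree v =
      (Finset.univ.filter fun u => u ≠ c ∧ p u ∈ s).card +
        (Finset.univ.filter fun u => u ≠ c ∧ u ∈ s).card := by
    rw [Finset.sum_congr rfl fun v _ => h.degree_eq v, Finset.sum_add_distrib]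
    congr 1
    · rw [Finset.card_eq_sum_card_fiberwise (f := p) (t := s)]
      · refine Finset.sum_congr rfl fun v hv => congrArg Finset.card ?_
        ext u
        simp only [Finset.mem_filter, Finset.mem_univ, true_and]
        constructor
        · rintro ⟨h2, rfl⟩
          exact ⟨⟨h2, hv⟩, rfl⟩
        · rintro ⟨⟨h2, -⟩, h3⟩
          exact ⟨h2, h3⟩
      · intro u hu
        exact (Finset.mem_filter.mp hu).2.2
    · have h2 : (Finset.univ.filter fun u => u ≠ c ∧ u ∈ s) = s.filter fun u => ¬ u = c := by
        ext u
        simp [and_comm]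
      rw [h2, Finset.card_filter]
      simp only [ite_not]
  have h2 : ∀ u, (if u ≠ c ∧ p u ∈ s then 1 else 0) + (if u ≠ c ∧ u ∈ s then 1 else 0) +
      (if u ∈ sᶜ ∧ u ≠ c ∧ p u ∈ sᶜ then 1 else 0) + (if u = c then 1 else 0) =
      (if u ∈ s ∧ u ≠ c ∧ p u ∈ s then 1 else 0) + 1 := by
    intro u
    by_cases h3 : u = c <;> by_cases h4 : u ∈ s <;> by_cases h5 : p u ∈ s <;> simp [h3, h4, h5]
  have h3 := Finset.sum_congr (rfl : (Finset.univ : Finset V) = Finset.univ) fun u _ => h2 u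
  simp only [Finset.sum_add_distrib, ← Finset.card_filter, Finset.sum_const, Finset.card_univ,
    smul_eq_mul, mul_one] at h3
  have h4 : (Finset.univ.filter fun u => u = c).card = 1 :=
    Finset.card_eq_one.mpr ⟨c, by ext; simp⟩
  rw [h1, insideEdges, insideEdges]
  omega

/-- Each vertex of `s` other than the root accounts for one inside edge, provided its parent is in
`s`. -/
theorem insideEdges_add_one_eq_iff (h : T.IsRootedBy c p d) {s : Finset V} (hc : c ∈ s) :
    insideEdges c p s + 1 = s.card ↔ ∀ v ∈ s, p v ∈ s := by
  have hsub : (Finset.univ.filter fun v => v ∈ s ∧ v ≠ c ∧ p v ∈ s) ⊆ s.erase c := by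
    intro v hv
    have hv' := (Finset.mem_filter.mp hv).2
    exact Finset.mem_erase.mpr ⟨hv'.2.1, hv'.1⟩
  have hcard := Finset.card_erase_add_one hc
  rw [← hcard, add_left_inj, insideEdges]
  constructor
  · intro heq v hv
    by_cases hvc : v = c
    · rw [hvc, h.root]
      exact hc
    · have h1 := Finset.eq_of_subset_of_card_le hsub heq.ge
      have h2 : v ∈ s.erase c := Finset.mem_erase.mpr ⟨hvc, hv⟩
      rw [← h1] at h2
      exact (Finset.mem_filter.mp h2).2.2.2
  · intro hs
    congr 1
    refine hsub.antisymm fun v hv => ?_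
    obtain ⟨h1, h2⟩ := Finset.mem_erase.mp hv
    exact Finset.mem_filter.mpr ⟨Finset.mem_univ v, h2, h1, hs v h2⟩

/-- The last two terms on the right are the defects: leaves of `T` in `s`, and excess degree outside
`s`. Membership of the root in `s` is not assumed, so this applies to any rooting. -/
theorem insideEdges_compl_add [Nontrivial V] (hT : T.IsTree) (h : T.IsRootedBy c p d)
    {s : Finset V} (hs : insideEdges c p s + 1 = s.card) :
    insideEdges c p sᶜ + s.card + 2 + T.degreeExcess =
      Fintype.card V + (s.filter fun v => T.degree v = 1).card + ∑ v ∈ sᶜ, (T.degree v - 2) := by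
  have h1 := h.sum_degree_add s
  have h3 : ∀ v, T.degree v + (if T.degree v = 1 then 1 else 0) = 2 + (T.degree v - 2) := by
    intro v
    have := hT.preconnected.degree_pos_of_nontrivial v
    split_ifs <;> omega
  have h4 := Finset.sum_congr (rfl : s = s) fun v _ => h3 v
  rw [Finset.sum_add_distrib, Finset.sum_add_distrib, ← Finset.card_filter, Finset.sum_const,
    smul_eq_mul] at h4
  rw [degreeExcess, ← Finset.sum_add_sum_compl s]
  omega

theorem insideEdges_compl_add_eq_iff [Nontrivial V] (hT : T.IsTree) (h : T.IsRootedBy c p d)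
    {s : Finset V} (hs : insideEdges c p s + 1 = s.card) :
    insideEdges c p sᶜ + s.card + 2 + T.degreeExcess = Fintype.card V ↔
      (∀ v, 3 ≤ T.degree v → v ∈ s) ∧ ∀ v ∈ s, T.degree v ≠ 1 := by
  rw [h.insideEdges_compl_add hT hs]
  have h1 : (s.filter fun v => T.degree v = 1).card = 0 ↔ ∀ v ∈ s, T.degree v ≠ 1 := by
    rw [Finset.card_eq_zero, Finset.filter_eq_empty_iff]
  have h2 : ∑ v ∈ sᶜ, (T.degree v - 2) = 0 ↔ ∀ v, 3 ≤ T.degree v → v ∈ s := by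
    rw [Finset.sum_eq_zero_iff]
    refine forall_congr' fun v => ?_
    rw [Finset.mem_compl, Nat.sub_eq_zero_iff_le]
    constructor
    · intro h2 hd
      by_contra hv
      have := h2 hv
      omega
    · intro h2 hv
      by_contra hd
      exact hv (h2 (by omega))
  rw [← h1, ← h2]
  omega

theorem isTrunkLike_and_leafless_iff [Nontrivial V] (hT : T.IsTree) (h : T.IsRootedBy c p d)
    (hc : 3 ≤ T.degree c) (s : Finset V) :
    (insideEdges c p s + 1 = s.card ∧
      insideEdges c p sᶜ + s.card + 2 + T.degreeExcess = Fintype.card V) ↔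
      (T.IsTrunkLike p s ∧ ∀ v ∈ s, T.degree v ≠ 1) := by
  constructor
  · rintro ⟨h1, h2⟩
    obtain ⟨h3, h4⟩ := (h.insideEdges_compl_add_eq_iff hT h1).mp h2
    exact ⟨⟨h3, (h.insideEdges_add_one_eq_iff (h3 c hc)).mp h1⟩, h4⟩
  · rintro ⟨⟨h1, h2⟩, h3⟩
    have h4 := (h.insideEdges_add_one_eq_iff (h1 c hc)).mpr h2
    exact ⟨h4, (h.insideEdges_compl_add_eq_iff hT h4).mpr ⟨h1, h3⟩⟩

open Polynomial in
/-- The generating function of the connected leafless sets of vertices that contain the trunk. -/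
theorem sum_X_pow_leafless (hT : T.IsTree) (h : T.IsRootedBy c p d) (hc : 3 ≤ T.degree c) :
    ((((Finset.univ : Finset (Finset V)).val.map
        fun s => (s.card, insideEdges c p s, insideEdges c p sᶜ)).filter fun x =>
          x.2.1 + 1 = x.1 ∧ x.2.2 + x.1 + 2 + T.degreeExcess = Fintype.card V).map
            fun x => (X : ℤ[X]) ^ (Fintype.card V - x.1)).sum =
      X ^ (2 + T.degreeExcess) *
        ∏ l : T.Tip c, ∑ i ∈ Finset.range (T.legLength p l), (X : ℤ[X]) ^ i := by
  have : Nontrivial V := by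
    obtain ⟨u, hu⟩ := (T.degree_pos_iff_exists_adj c).mp (by omega)
    exact ⟨⟨c, u, hu.ne⟩⟩
  have hS : ∀ s, s ∈ (Finset.univ.filter fun s => insideEdges c p s + 1 = s.card ∧
      insideEdges c p sᶜ + s.card + 2 + T.degreeExcess = Fintype.card V) ↔
        T.IsTrunkLike p s ∧ ∀ v ∈ s, T.degree v ≠ 1 := fun s => by
    simpa using h.isTrunkLike_and_leafless_iff hT hc s
  have h1 := h.sum_X_pow_card_compl hc hS _ (fun l i hi => (Finset.mem_Icc.mp hi).2)
    fun k hk => h.compl_legCut_leafless_iff hc hk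
  -- Each leg loses at least its leaf, which yields one factor `X` per leg.
  have h2 : ∀ a, ∑ i ∈ Finset.Icc 1 a, (X : ℤ[X]) ^ i =
      X * ∑ i ∈ Finset.range a, (X : ℤ[X]) ^ i := by
    intro a
    have h3 := Finset.sum_Ico_add' (fun i => (X : ℤ[X]) ^ i) 0 a 1
    rw [zero_add, Finset.Ico_add_one_right_eq_Icc] at h3
    rw [Finset.mul_sum, Finset.range_eq_Ico, ← h3]
    exact Finset.sum_congr rfl fun i _ => pow_succ' X i
  rw [Finset.prod_congr rfl fun l _ => h2 _, Finset.prod_mul_distrib, Finset.prod_const,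
    Finset.card_univ, hT.card_tip hc] at h1
  rw [← h1, Multiset.filter_map, Multiset.map_map, ← Finset.filter_val]
  refine Finset.sum_congr rfl fun s hs => ?_
  simp only [Function.comp_apply]
  rw [Finset.card_compl]

end IsRootedBy

/-- The trunk of `T` attains equality in the lower bound. A set in `T'` with the same triple obeys
the bound for `T'`, which compares the two excesses. -/
theorem degreeExcess_le_of_chromaticSymmetricFunction_eq (hT : T.IsTree) (hT' : T'.IsTree)
    (hX : T.chromaticSymmetricFunction = T'.chromaticSymmetricFunction) :
    T.degreeExcess ≤ T'.degreeExcess := by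
  rcases Nat.eq_zero_or_pos T.degreeExcess with h0 | h0
  · omega
  · obtain ⟨c, hc⟩ := exists_three_le_degree_iff.mpr h0
    obtain ⟨p, d, h⟩ := hT.exists_isRootedBy c
    obtain ⟨w⟩ := hT'.connected.nonempty
    obtain ⟨p', d', h'⟩ := hT'.exists_isRootedBy w
    have hV : Nontrivial V := by
      obtain ⟨u, hu⟩ := (T.degree_pos_iff_exists_adj c).mp (by omega)
      exact ⟨⟨c, u, hu.ne⟩⟩
    have hcard := card_eq_of_chromaticSymmetricFunction_eq hX
    have : Nontrivial W := by
      rw [← Fintype.one_lt_card_iff_nontrivial] at hV ⊢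
      omega
    have hle : ∀ l : T.Tip c, T.legLength p l ≤ T.legLength p l := fun l => le_rfl
    have hc2 : T.degree c ≠ 2 := by omega
    obtain ⟨h1, h2⟩ := (h.isTrunkLike_and_leafless_iff hT hc _).mpr
      ⟨h.isTrunkLike_compl_legCut hc2 (k := fun l : T.Tip c => T.legLength p l) hle,
        (h.compl_legCut_leafless_iff hc hle).mpr fun l =>
          Finset.mem_Icc.mpr ⟨(h.legLength_spec hc2 l.2.1).1, le_rfl⟩⟩
    have hmem := Multiset.mem_map_of_mem
      (fun s => (s.card, insideEdges c p s, insideEdges c p sᶜ))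
      (Finset.mem_univ_val (T.legCut c p fun l => T.legLength p l)ᶜ)
    rw [map_insideEdges_eq hX h h'] at hmem
    obtain ⟨s, -, hs⟩ := Multiset.mem_map.mp hmem
    simp only [Prod.mk.injEq] at hs
    obtain ⟨h3, h4, h5⟩ := hs
    rw [← h3, ← h4] at h1
    have h6 := h'.insideEdges_compl_add hT' h1
    omega

theorem trunk_twigs_eq_of_chromaticSymmetricFunction_eq (hT : T.IsTree) (hT' : T'.IsTree)
    (hX : T.chromaticSymmetricFunction = T'.chromaticSymmetricFunction) :
    T.trunk.ncard = T'.trunk.ncard ∧ T.twigLengths = T'.twigLengths := by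
  have hn := card_eq_of_chromaticSymmetricFunction_eq hX
  have hx := le_antisymm (degreeExcess_le_of_chromaticSymmetricFunction_eq hT hT' hX)
    (degreeExcess_le_of_chromaticSymmetricFunction_eq hT' hT hX.symm)
  refine trunk_twigs_eq_of_prod_eq hT hT' hn hx fun hc h hc' h' => ?_
  have h1 := h.sum_X_pow_leafless hT hc
  rw [map_insideEdges_eq hX h h', hn, hx, h'.sum_X_pow_leafless hT' hc'] at h1
  exact (mul_left_cancel₀ (pow_ne_zero _ Polynomial.X_ne_zero) h1).symm

end InsideEdges

end SimpleGraph
namespace SimpleGraph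

/-! ### Reconstructing spiders -/

section Spiders

open scoped Classical

theorem exists_equiv_of_map_univ_eq {α β γ : Type*} [Fintype α] [Fintype β] {f : α → γ} {g : β → γ}
    (h : (Finset.univ : Finset α).val.map f = (Finset.univ : Finset β).val.map g) :
    ∃ e : α ≃ β, ∀ a, g (e a) = f a := by
  have hcard : ∀ x, Nonempty ({a // f a = x} ≃ {b // g b = x}) := by
    intro x
    have h1 := congrArg (Multiset.count x) h
    rw [Multiset.count_map, Multiset.count_map, ← Finset.filter_val, ← Finset.filter_val,
      Finset.card_val, Finset.card_val] at h1
    rw [← Fintype.card_eq, Fintype.card_subtype, Fintype.card_subtype]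
    simpa only [eq_comm] using h1
  exact ⟨Equiv.ofFiberEquiv fun x => (hcard x).some, Equiv.ofFiberEquiv_map _⟩

variable {V W : Type*} [Fintype V] [Fintype W] {T : SimpleGraph V} {T' : SimpleGraph W}
  {c : V} {p : V → V} {d : V → ℕ} {c' : W} {p' : W → W} {d' : W → ℕ}

namespace IsRootedBy

theorem iterate_eq_iterate_iff (h : T.IsRootedBy c p d) (hc : T.degree c ≠ 2)
    (hend : ∀ l : T.Tip c, p^[T.legLength p l] l = c) (l m : T.Tip c) (i j : ℕ) :
    p^[i] (l : V) = p^[j] m ↔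
      (l = m ∧ i = j) ∨ (T.legLength p l ≤ i ∧ T.legLength p m ≤ j) := by
  constructor
  · intro heq
    rcases Nat.lt_or_ge j (T.legLength p m) with hj | hj
    · obtain ⟨h1, h2⟩ := h.eq_of_iterate_eq hc m.2.1 l.2.2 m.2.2 hj heq
      exact Or.inl ⟨Subtype.ext h1, h2⟩
    · rcases Nat.lt_or_ge i (T.legLength p l) with hi | hi
      · obtain ⟨h1, h2⟩ := h.eq_of_iterate_eq hc l.2.1 m.2.2 l.2.2 hi heq.symm
        exact Or.inl ⟨Subtype.ext h1.symm, h2.symm⟩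
      · exact Or.inr ⟨hi, hj⟩
  · rintro (⟨rfl, rfl⟩ | ⟨hi, hj⟩)
    · rfl
    · rw [h.iterate_eq_root_of_le (hend l) hi, h.iterate_eq_root_of_le (hend m) hj]

/-- Two trees that consist of legs attached to the root are isomorphic if their legs have the same
lengths. -/
theorem nonempty_iso_of_legLength_eq [Nontrivial V] [Nontrivial W] (h : T.IsRootedBy c p d)
    (hc : T.degree c ≠ 2) (hend : ∀ l : T.Tip c, p^[T.legLength p l] l = c)
    (h' : T'.IsRootedBy c' p' d') (hc' : T'.degree c' ≠ 2)
    (hend' : ∀ l : T'.Tip c', p'^[T'.legLength p' l] l = c')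
    (σ : T.Tip c ≃ T'.Tip c') (hσ : ∀ l, T'.legLength p' (σ l) = T.legLength p l) :
    Nonempty (T ≃g T') := by
  choose tip pos hpos using h.exists_tip_iterate_eq
  have hiff : ∀ (l m : T.Tip c) (i j : ℕ),
      p'^[i] (σ l : W) = p'^[j] (σ m : W) ↔ p^[i] (l : V) = p^[j] m := by
    intro l m i j
    rw [h.iterate_eq_iterate_iff hc hend, h'.iterate_eq_iterate_iff hc' hend', hσ, hσ,
      σ.apply_eq_iff_eq]
  -- Each vertex is written as a chosen leaf moved up a chosen number of steps; `hiff` makes the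
  -- image independent of these choices.
  obtain ⟨f, hf⟩ : ∃ f : V → W, ∀ (l : T.Tip c) (i : ℕ), f (p^[i] l) = p'^[i] (σ l : W) :=
    ⟨fun v => p'^[pos v] (σ (tip v) : W), fun l i => (hiff _ _ _ _).mpr (hpos _)⟩
  have hinj : Function.Injective f := by
    intro u v huv
    rw [← hpos u, ← hpos v] at huv ⊢
    rwa [hf, hf, hiff] at huv
  have hsurj : Function.Surjective f := by
    intro w
    obtain ⟨l, i, rfl⟩ := h'.exists_tip_iterate_eq w
    exact ⟨p^[i] (σ.symm l : V), by rw [hf, σ.apply_symm_apply]⟩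
  have hp : ∀ v, f (p v) = p' (f v) := by
    intro v
    rw [← hpos v, ← Function.iterate_succ_apply' p, hf, hf, Function.iterate_succ_apply']
  refine ⟨⟨Equiv.ofBijective f ⟨hinj, hsurj⟩, ?_⟩⟩
  intro u v
  change T'.Adj (f u) (f v) ↔ T.Adj u v
  rw [h.adj_iff, h'.adj_iff, ← hp, ← hp,
    hinj.eq_iff, hinj.eq_iff, hinj.ne_iff]

end IsRootedBy

/-- Rooted at one end, a path with at least one edge is a single leg. -/
theorem nonempty_iso_of_degree_le_two (hT : T.IsTree) (hT' : T'.IsTree)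
    (hd : ∀ v, T.degree v ≤ 2) (hd' : ∀ v, T'.degree v ≤ 2)
    (hn : Fintype.card V = Fintype.card W) : Nonempty (T ≃g T') := by
  rcases subsingleton_or_nontrivial V with hV | hV
  · have hW : Subsingleton W := by
      rw [← Fintype.card_le_one_iff_subsingleton] at hV ⊢
      omega
    refine ⟨⟨Fintype.equivOfCardEq hn, ?_⟩⟩
    intro u v
    exact iff_of_false (fun h => h.ne (Subsingleton.elim _ _))
      fun h => h.ne (Subsingleton.elim _ _)
  · have hW : Nontrivial W := by
      rw [← Fintype.one_lt_card_iff_nontrivial] at hV ⊢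
      omega
    obtain ⟨l, c, hlc, hl, hc⟩ := hT.exists_ne_and_degree_eq_one
    obtain ⟨l', c', hlc', hl', hc'⟩ := hT'.exists_ne_and_degree_eq_one
    replace hl : T.degree l = 1 := by convert hl
    replace hc : T.degree c = 1 := by convert hc
    replace hl' : T'.degree l' = 1 := by convert hl'
    replace hc' : T'.degree c' = 1 := by convert hc'
    obtain ⟨p, d, h⟩ := hT.exists_isRootedBy c
    obtain ⟨p', d', h'⟩ := hT'.exists_isRootedBy c'
    have hc2 : T.degree c ≠ 2 := by omega
    have hc2' : T'.degree c' ≠ 2 := by omega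
    let _ : Unique (T.Tip c) := ⟨⟨⟨l, hlc, hl⟩⟩, fun m =>
      Subtype.ext (hT.eq_tip_of_degree_le_two hd hc m.2.1 m.2.2 hlc hl)⟩
    let _ : Unique (T'.Tip c') := ⟨⟨⟨l', hlc', hl'⟩⟩, fun m =>
      Subtype.ext (hT'.eq_tip_of_degree_le_two hd' hc' m.2.1 m.2.2 hlc' hl')⟩
    refine h.nonempty_iso_of_legLength_eq hc2 (fun m => ?_) h' hc2' (fun m => ?_)
      (Equiv.ofUnique _ _) fun m => ?_
    · rcases h.iterate_legLength hc2 m.2.1 with h1 | h1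
      · exact h1
      · exact absurd (hd _) (Nat.not_le_of_lt h1)
    · rcases h'.iterate_legLength hc2' m.2.1 with h1 | h1
      · exact h1
      · exact absurd (hd' _) (Nat.not_le_of_lt h1)
    · have h1 := h.legLength_of_degree_le_two hT hd hc m.2.1 m.2.2
      have h2 := h'.legLength_of_degree_le_two hT' hd' hc'
        (Equiv.ofUnique (T.Tip c) (T'.Tip c') m).2.1 (Equiv.ofUnique (T.Tip c) (T'.Tip c') m).2.2
      omega

theorem trunk_eq_singleton (hc : 3 ≤ T.degree c) (huniq : ∀ v, 3 ≤ T.degree v → v = c) :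
    T.trunk = {c} := by
  apply subset_antisymm
  · refine Set.sInter_subset_of_mem ⟨?_, huniq⟩
    rintro ⟨x, hx⟩ ⟨y, hy⟩
    rw [Set.mem_singleton_iff] at hx hy
    subst hx hy
    rfl
  · rintro _ rfl s ⟨-, hs⟩
    exact hs _ hc

theorem mem_trunk_of_degree {v : V} (hv : 3 ≤ T.degree v) : v ∈ T.trunk :=
  fun _ hs => hs.2 v hv

/-- A trunk of size `1` or `0` forces `T'` to have exactly one or no vertex of degree at least `3`;
then the leg lengths, or the order alone, determine the tree. -/
theorem IsSpider.nonempty_iso (hT : T.IsSpider) (hT' : T'.IsTree)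
    (hn : Fintype.card V = Fintype.card W) (htrunk : T.trunk.ncard = T'.trunk.ncard)
    (htwig : T.twigLengths = T'.twigLengths) : Nonempty (T ≃g T') := by
  obtain ⟨hT, hsub⟩ := hT
  by_cases hex : ∃ c, 3 ≤ T.degree c
  · obtain ⟨c, hc⟩ := hex
    have huniq : ∀ v, 3 ≤ T.degree v → v = c := fun v hv => hsub hv hc
    rw [trunk_eq_singleton hc huniq, Set.ncard_singleton] at htrunk
    obtain ⟨c', hc'⟩ : ∃ c', 3 ≤ T'.degree c' := by
      by_contra hne
      push Not at hne
      rw [trunk_eq_empty fun v => Nat.le_of_lt_succ (hne v)] at htrunk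
      simp at htrunk
    obtain ⟨w, hw⟩ := Set.ncard_eq_one.mp htrunk.symm
    have huniq' : ∀ v, 3 ≤ T'.degree v → v = c' := by
      intro v hv
      have h1 := mem_trunk_of_degree hv
      have h2 := mem_trunk_of_degree hc'
      rw [hw, Set.mem_singleton_iff] at h1 h2
      rw [h1, h2]
    obtain ⟨p, d, h⟩ := hT.exists_isRootedBy c
    obtain ⟨p', d', h'⟩ := hT'.exists_isRootedBy c'
    have hc2 : T.degree c ≠ 2 := by omega
    have hc2' : T'.degree c' ≠ 2 := by omega
    rw [h.twigLengths_eq hc, h'.twigLengths_eq hc'] at htwig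
    obtain ⟨σ, hσ⟩ := exists_equiv_of_map_univ_eq htwig
    have hV : Nontrivial V := by
      obtain ⟨u, hu⟩ := (T.degree_pos_iff_exists_adj c).mp (by omega)
      exact ⟨⟨c, u, hu.ne⟩⟩
    have hW : Nontrivial W := by
      rw [← Fintype.one_lt_card_iff_nontrivial] at hV ⊢
      omega
    refine h.nonempty_iso_of_legLength_eq hc2 (fun m => ?_) h' hc2' (fun m => ?_) σ hσ
    · exact (h.iterate_legLength hc2 m.2.1).elim id (huniq _)
    · exact (h'.iterate_legLength hc2' m.2.1).elim id (huniq' _)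
  · push Not at hex
    have hd : ∀ v, T.degree v ≤ 2 := fun v => Nat.le_of_lt_succ (hex v)
    rw [trunk_eq_empty hd, Set.ncard_empty, eq_comm, Set.ncard_eq_zero] at htrunk
    refine nonempty_iso_of_degree_le_two hT hT' hd (fun v => ?_) hn
    by_contra hv
    have h1 := mem_trunk_of_degree (T := T') (v := v) (by omega)
    rw [htrunk] at h1
    exact h1

end Spiders

end SimpleGraph

theorem mainTheorem1 {V W : Type*} [Fintype V] [Fintype W]
    (T : SimpleGraph V) (T' : SimpleGraph W) (hT : T.IsTree) (hT' : T'.IsTree) :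
    (T.subtreePolynomial = T'.subtreePolynomial →
      T.trunk.ncard = T'.trunk.ncard ∧ T.twigLengths = T'.twigLengths) ∧
    (T.chromaticSymmetricFunction = T'.chromaticSymmetricFunction →
      T.trunk.ncard = T'.trunk.ncard ∧ T.twigLengths = T'.twigLengths) ∧
    (T.IsSpider → T.chromaticSymmetricFunction = T'.chromaticSymmetricFunction →
      Nonempty (T ≃g T')) := by
  refine ⟨SimpleGraph.trunk_twigs_eq_of_subtreePolynomial_eq hT hT',
    SimpleGraph.trunk_twigs_eq_of_chromaticSymmetricFunction_eq hT hT', fun hs hX => ?_⟩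
  obtain ⟨h1, h2⟩ := SimpleGraph.trunk_twigs_eq_of_chromaticSymmetricFunction_eq hT hT' hX
  exact hs.nonempty_iso hT' (SimpleGraph.card_eq_of_chromaticSymmetricFunction_eq hX) h1 h2
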